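/- Fix $\mathbb F=\mathbb R$ or $\mathbb F=\mathbb C$. A \emph{space} means a separable $p$-Banach space $\mathbb X$ over $\mathbb F$ for some $p\in(0,1]$: a complete space with a quasi-norm satisfying $\|f+g\|^p\le\|f\|^p+\|g\|^p$. A \emph{fundamental minimal system} of $\mathbb X$ is a sequence $\mathcal X=(x_n)_{n\ge1}$ with dense linear span that has a (necessarily unique) biorthogonal sequence $(x_n^*)_{n\ge 1}$ in $\mathbb X^*$; we assume throughout that $\sup_n\|x_n\|<\infty$ and $\sup_n\|x_n^*\|<\infty$. It is a \emph{Markushevich basis} if the linear span of $(x_n^*)$ is weak-$*$ dense in $\mathbb X^*$, and a \emph{Schauder basis} if in addition the partial sum projections $f\mapsto\sum_{n\le m}x_n^*(f)x_n$, $m\ge 1$, are uniformly bounded. For finite $A\subset\mathbb N$ and signs $\varepsilon=(\varepsilon_n)_{n\in A}$, $|\varepsilon_n|=1$, put $\mathbf 1_{\varepsilon,A}=\sum_{n\in A}\varepsilon_nx_n$ and $\mathbf 1_A=\sum_{n\in A}x_n$; put $\operatorname{supp}f=\{n: x_n^*(f)\ne0\}$. A finite set $B$ is a \emph{greedy set}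 of $f$ if $|x_n^*(f)|\ge|x_k^*(f)|$ for all $n\in B$, $k\notin B$. For $m\ge1$ define: - $\lambda_m$, the smallest constant $C$ with $\min_{n\in B}|x_n^*(f)|\,\|\mathbf 1_{\varepsilon,A}\|\le C\|f\|$ for all $f\in\mathbb X$, all nonempty greedy sets $B$ of $f$, all $A$ with $|A|=|B|\le m$ and all signs $\varepsilon$ on $A$; and $\lambda_m^d$, the smallest constant when one requires in addition $A\cap\operatorname{supp}f=\emptyset$; - $\mu_m=\sup\|\mathbf 1_A\|/\|\mathbf 1_B\|$ over nonempty $A,B$ with $|A|=|B|\le m$, and $\tilde\mu_m=\sup\|\mathbf 1_{\varepsilon,A}\|/\|\mathbf 1_{\delta,B}\|$ over the same $A,B$ and all signs $\varepsilon$ on $A$, $\delta$ on $B$; - $\nu_m=\sup\|\mathbf 1_{\varepsilon,A}+f\|/\|\mathbf 1_{\delta,B}+f\|$ over finite $A,B$ with $|A|=|B|\le m$, signs $\varepsilon$ on $A$, $\delta$ on $B$, and $f\in\mathbb X$ with $\sup_n|x_n^*(f)|\le1$ and $\operatorname{supp}f\cap(A\cup B)=\emptyset$ (with nonzero denominator).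 For parameters $a_m,b_m$ let $U_B(a_m,b_m)$ be the set of all $R\in\mathbb R$ such that for every space $\mathbb X$ and every fundamental minimal system $\mathcal X$ of $\mathbb X$ one has $\sup_{m\ge1}a_m/b_m^R\le C$ for some finite $C=C(\mathcal X,\mathbb X)$. Let $U_M$ and $U_S$ be defined in the same way with Markushevich bases and Schauder bases respectively in place of fundamental minimal systems, and put $\mathfrak R_B=\inf U_B$, $\mathfrak R_M=\inf U_M$, $\mathfrak R_S=\inf U_S$. \textbf{Theorem.} $\mathfrak R_S(\lambda_m,\lambda_m^d)=1$, while $\mathfrak R_B(a_m,\lambda_m^d)=\mathfrak R_M(a_m,\lambda_m^d)=2$ for each of $a_m=\lambda_m,\ \mu_m,\ \tilde\mu_m,\ \nu_m$. Moreover, for each of these four parameters the power $2$ in the estimate $a_m\lesssim(\lambda_m^d)^2$ is optimal: $2\in U_B(a_m,\lambda_m^d)$, whereas $r\notin U_M(a_m,\lambda_m^d)$ for every real $r<2$. -/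

import Mathlib

open scoped ENNReal NNReal Topology

universe u

noncomputable section

/-- `X` is a separable `p`-Banach space over `𝕜` for some `p ∈ (0, 1]`: a complete separable
topological vector space whose topology is the one given by a `p`-subadditive quasi-norm `qnorm`.
(As `X` is a uniform group, its uniform structure is determined by the neighbourhoods of `0`,
which are required to be generated by the `qnorm`-balls.) -/
class PBanachSpace (𝕜 : Type) [RCLike 𝕜] (X : Type u) [AddCommGroup X] [Module 𝕜 X]
    [UniformSpace X] [IsUniformAddGroup X] where
  /-- the quasi-norm -/
  qnorm : X → ℝ
  qnorm_nonneg : ∀ f, 0 ≤ qnorm f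
  qnorm_eq_zero_iff : ∀ f, qnorm f = 0 ↔ f = 0
  qnorm_smul : ∀ (c : 𝕜) (f : X), qnorm (c • f) = ‖c‖ * qnorm f
  exists_subadditive : ∃ p : ℝ, 0 < p ∧ p ≤ 1 ∧
    ∀ f g, qnorm (f + g) ^ p ≤ qnorm f ^ p + qnorm g ^ p
  nhds_zero_basis : (𝓝 (0 : X)).HasBasis (fun r : ℝ => 0 < r) (fun r => {f | qnorm f < r})
  complete : CompleteSpace X
  separable : TopologicalSpace.SeparableSpace X

/-- A fundamental minimal system of a `p`-Banach space together with its dual system, both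
bounded. The indices start at `0`. The dual system is determined by the vectors, see
`FundamentalMinimalSystem.dual_unique`. -/
structure FundamentalMinimalSystem (𝕜 : Type) [RCLike 𝕜] (X : Type u) [AddCommGroup X]
    [Module 𝕜 X] [UniformSpace X] [IsUniformAddGroup X] [PBanachSpace 𝕜 X] where
  /-- the vectors `x_n` -/
  vec : ℕ → X
  /-- the coordinate functionals `x_n^*` -/
  dual : ℕ → X →L[𝕜] 𝕜
  dense_span : Dense (Submodule.span 𝕜 (Set.range vec) : Set X)
  biorthogonal : ∀ i j, dual i (vec j) = if i = j then 1 else 0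
  bounded_vec : ∃ C : ℝ, ∀ n, PBanachSpace.qnorm 𝕜 (vec n) ≤ C
  bounded_dual : ∃ C : ℝ, ∀ n f, ‖dual n f‖ ≤ C * PBanachSpace.qnorm 𝕜 f

namespace FundamentalMinimalSystem

section

variable {𝕜 : Type} [RCLike 𝕜] {X : Type u} [AddCommGroup X] [Module 𝕜 X]
  [UniformSpace X] [IsUniformAddGroup X] [PBanachSpace 𝕜 X]

theorem dual_unique (S : FundamentalMinimalSystem 𝕜 X) (φ : ℕ → X →L[𝕜] 𝕜)
    (h : ∀ i j, φ i (S.vec j) = if i = j then 1 else 0) : φ = S.dual := by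
  funext i
  refine ContinuousLinearMap.ext_on S.dense_span ?_
  rintro _ ⟨j, rfl⟩
  rw [h, S.biorthogonal]

/-- Markushevich basis: the linear span of the dual system is weak-* dense in the dual space. -/
def IsMarkushevich (S : FundamentalMinimalSystem 𝕜 X) : Prop :=
  Dense (Submodule.span 𝕜 (Set.range fun n => StrongDual.toWeakDual (S.dual n)) :
    Set (WeakDual 𝕜 X))

/-- The projection `P_A(f) = ∑_{n ∈ A} x_n^*(f) x_n`. -/
def proj (S : FundamentalMinimalSystem 𝕜 X) (A : Finset ℕ) (f : X) : X :=
  ∑ n ∈ A, S.dual n f • S.vec n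

/-- Schauder basis: a Markushevich basis whose partial sum projections are uniformly bounded. -/
def IsSchauder (S : FundamentalMinimalSystem 𝕜 X) : Prop :=
  S.IsMarkushevich ∧ ∃ K : ℝ, ∀ (m : ℕ) (f : X),
    PBanachSpace.qnorm 𝕜 (S.proj (Finset.range m) f) ≤ K * PBanachSpace.qnorm 𝕜 f

/-- The indicator sum `1_{ε, A} = ∑_{n ∈ A} ε_n x_n`. -/
def signedSum (S : FundamentalMinimalSystem 𝕜 X) (ε : ℕ → 𝕜) (A : Finset ℕ) : X :=
  ∑ n ∈ A, ε n • S.vec n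

/-- `1_A = ∑_{n ∈ A} x_n`. -/
def indicatorSum (S : FundamentalMinimalSystem 𝕜 X) (A : Finset ℕ) : X :=
  ∑ n ∈ A, S.vec n

/-- `B` is a greedy set of `f` (of order `#B`). -/
def IsGreedySet (S : FundamentalMinimalSystem 𝕜 X) (f : X) (B : Finset ℕ) : Prop :=
  ∀ n ∈ B, ∀ k, k ∉ B → ‖S.dual k f‖ ≤ ‖S.dual n f‖

/-- The set `supp f` of all `n` with `x_n^*(f) ≠ 0`. -/
def supp (S : FundamentalMinimalSystem 𝕜 X) (f : X) : Set ℕ :=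
  {n | S.dual n f ≠ 0}

end

end FundamentalMinimalSystem

/-- `ε` is a family of signs on `A`, i.e. `ε_n` has modulus one for all `n ∈ A`. The values of `ε`
outside `A` are irrelevant. -/
def IsSignOn {𝕜 : Type} [RCLike 𝕜] (ε : ℕ → 𝕜) (A : Finset ℕ) : Prop :=
  ∀ n ∈ A, ‖ε n‖ = 1

/-- A parameter assigns a sequence of numbers in `[0, ∞]` to every fundamental minimal system of
every separable `p`-Banach space over `𝕜`. -/
abbrev BasisParameter (𝕜 : Type) [RCLike 𝕜] : Type (u + 1) :=
  ∀ (X : Type u) [AddCommGroup X] [Module 𝕜 X] [UniformSpace X] [IsUniformAddGroup X]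
    [PBanachSpace 𝕜 X], FundamentalMinimalSystem 𝕜 X → ℕ → ℝ≥0∞

section

variable (𝕜 : Type) [RCLike 𝕜]

/-- The squeeze symmetry parameter `λ_m`: the smallest `C` such that
`min_{n ∈ B} |x_n^*(f)| ‖1_{ε, A}‖ ≤ C ‖f‖` for all `f`, all greedy sets `B` of `f`, all `A` with
`#B = #A ≤ m` and all signs `ε`. (The minimum makes sense only for nonempty `B`.) -/
def squeezeSymmetry : BasisParameter.{u} 𝕜 := fun X _ _ _ _ _ S m =>
  sInf {C : ℝ≥0∞ | ∀ (f : X) (A B : Finset ℕ) (hB : B.Nonempty) (ε : ℕ → 𝕜),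
    S.IsGreedySet f B → B.card = A.card → A.card ≤ m → IsSignOn ε A →
      ENNReal.ofReal ((B.inf' hB fun n => ‖S.dual n f‖) * PBanachSpace.qnorm 𝕜 (S.signedSum ε A))
        ≤ C * ENNReal.ofReal (PBanachSpace.qnorm 𝕜 f)}

/-- The disjoint squeeze symmetry parameter `λ_m^d`: as `λ_m`, but only for those `A` that are
disjoint from the support of `f`. -/
def disjointSqueezeSymmetry : BasisParameter.{u} 𝕜 := fun X _ _ _ _ _ S m =>
  sInf {C : ℝ≥0∞ | ∀ (f : X) (A B : Finset ℕ) (hB : B.Nonempty) (ε : ℕ → 𝕜),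
    S.IsGreedySet f B → B.card = A.card → A.card ≤ m → IsSignOn ε A →
    Disjoint (A : Set ℕ) (S.supp f) →
      ENNReal.ofReal ((B.inf' hB fun n => ‖S.dual n f‖) * PBanachSpace.qnorm 𝕜 (S.signedSum ε A))
        ≤ C * ENNReal.ofReal (PBanachSpace.qnorm 𝕜 f)}

/-- The democracy parameter `μ_m`. (The pair `A = B = ∅` contributes `0 / 0 = 0` to the
supremum.) -/
def democracy : BasisParameter.{u} 𝕜 := fun _ _ _ _ _ _ S m =>
  ⨆ (A : Finset ℕ) (B : Finset ℕ) (_ : A.card = B.card) (_ : B.card ≤ m),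
    ENNReal.ofReal (PBanachSpace.qnorm 𝕜 (S.indicatorSum A) /
      PBanachSpace.qnorm 𝕜 (S.indicatorSum B))

/-- The super-democracy parameter `μ̃_m`. -/
def superDemocracy : BasisParameter.{u} 𝕜 := fun _ _ _ _ _ _ S m =>
  ⨆ (A : Finset ℕ) (B : Finset ℕ) (ε : ℕ → 𝕜) (δ : ℕ → 𝕜) (_ : A.card = B.card)
    (_ : B.card ≤ m) (_ : IsSignOn ε A) (_ : IsSignOn δ B),
    ENNReal.ofReal (PBanachSpace.qnorm 𝕜 (S.signedSum ε A) /
      PBanachSpace.qnorm 𝕜 (S.signedSum δ B))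

/-- The symmetry for largest coefficients parameter `ν_m`. -/
def symmetryLargest : BasisParameter.{u} 𝕜 := fun X _ _ _ _ _ S m =>
  ⨆ (A : Finset ℕ) (B : Finset ℕ) (ε : ℕ → 𝕜) (δ : ℕ → 𝕜) (f : X) (_ : A.card = B.card)
    (_ : B.card ≤ m) (_ : IsSignOn ε A) (_ : IsSignOn δ B) (_ : ∀ n, ‖S.dual n f‖ ≤ 1)
    (_ : Disjoint (S.supp f) ((A : Set ℕ) ∪ (B : Set ℕ))),
    ENNReal.ofReal (PBanachSpace.qnorm 𝕜 (S.signedSum ε A + f) /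
      PBanachSpace.qnorm 𝕜 (S.signedSum δ B + f))

variable {𝕜}

/-- The exponents `R` such that, for every space and every fundamental minimal system,
`sup_{m ≥ 1} a_m / b_m ^ R` is bounded by a finite constant (depending on the system and the
space). -/
def exponentsB (a b : BasisParameter.{u} 𝕜) : Set ℝ :=
  {R | ∀ (X : Type u) [AddCommGroup X] [Module 𝕜 X] [UniformSpace X] [IsUniformAddGroup X]
    [PBanachSpace 𝕜 X] (S : FundamentalMinimalSystem 𝕜 X),
      ∃ C : ℝ≥0, ∀ m : ℕ, 1 ≤ m → a X S m / b X S m ^ R ≤ C}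

/-- As `exponentsB`, for Markushevich bases only. -/
def exponentsM (a b : BasisParameter.{u} 𝕜) : Set ℝ :=
  {R | ∀ (X : Type u) [AddCommGroup X] [Module 𝕜 X] [UniformSpace X] [IsUniformAddGroup X]
    [PBanachSpace 𝕜 X] (S : FundamentalMinimalSystem 𝕜 X), S.IsMarkushevich →
      ∃ C : ℝ≥0, ∀ m : ℕ, 1 ≤ m → a X S m / b X S m ^ R ≤ C}

/-- As `exponentsB`, for Schauder bases only. -/
def exponentsS (a b : BasisParameter.{u} 𝕜) : Set ℝ :=
  {R | ∀ (X : Type u) [AddCommGroup X] [Module 𝕜 X] [UniformSpace X] [IsUniformAddGroup X]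
    [PBanachSpace 𝕜 X] (S : FundamentalMinimalSystem 𝕜 X), S.IsSchauder →
      ∃ C : ℝ≥0, ∀ m : ℕ, 1 ≤ m → a X S m / b X S m ^ R ≤ C}

/-- The ratio function `ℜ_B(a, b)`, an extended real number (`+∞` if there is no exponent). -/
def ratioB (a b : BasisParameter.{u} 𝕜) : EReal :=
  sInf ((fun R : ℝ => (R : EReal)) '' exponentsB a b)

/-- The ratio function `ℜ_M(a, b)`. -/
def ratioM (a b : BasisParameter.{u} 𝕜) : EReal :=
  sInf ((fun R : ℝ => (R : EReal)) '' exponentsM a b)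

/-- The ratio function `ℜ_S(a, b)`. -/
def ratioS (a b : BasisParameter.{u} 𝕜) : EReal :=
  sInf ((fun R : ℝ => (R : EReal)) '' exponentsS a b)

/-- The estimate `a_m ≲ b_m ^ s` holds for all fundamental minimal systems, and its power cannot
be improved, not even for Markushevich bases: for every `r < s` there is a Markushevich basis for
which `a_m / b_m ^ r` is unbounded. -/
def IsOptimalPower (a b : BasisParameter.{u} 𝕜) (s : ℝ) : Prop :=
  s ∈ exponentsB a b ∧ ∀ r : ℝ, r < s → r ∉ exponentsM a b

end

end

noncomputable section

namespace PBanachSpace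

variable {𝕜 : Type} [RCLike 𝕜] {X : Type u} [AddCommGroup X] [Module 𝕜 X]
  [UniformSpace X] [IsUniformAddGroup X] [PBanachSpace 𝕜 X]

theorem qnorm_zero : qnorm 𝕜 (0 : X) = 0 := (qnorm_eq_zero_iff 0).2 rfl

theorem qnorm_pos {f : X} (hf : f ≠ 0) : 0 < qnorm 𝕜 f :=
  (qnorm_nonneg f).lt_of_ne fun h => hf ((qnorm_eq_zero_iff (𝕜 := 𝕜) f).1 h.symm)

theorem qnorm_neg (f : X) : qnorm 𝕜 (-f) = qnorm 𝕜 f := by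
  simpa using qnorm_smul (-1 : 𝕜) f

variable (𝕜 X) in
theorem exists_qnorm_add_le :
    ∃ K : ℝ, 1 ≤ K ∧ ∀ f g : X, qnorm 𝕜 (f + g) ≤ K * (qnorm 𝕜 f + qnorm 𝕜 g) := by
  obtain ⟨p, hp, -, h⟩ := exists_subadditive (𝕜 := 𝕜) (X := X)
  refine ⟨2 ^ p⁻¹, Real.one_le_rpow one_le_two (inv_pos.2 hp).le, fun f g => ?_⟩
  have hf := qnorm_nonneg (𝕜 := 𝕜) f
  have hg := qnorm_nonneg (𝕜 := 𝕜) g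
  rw [← Real.rpow_le_rpow_iff (qnorm_nonneg _) (by positivity) hp,
    Real.mul_rpow (by positivity) (by positivity), ← Real.rpow_mul zero_le_two,
    inv_mul_cancel₀ hp.ne', Real.rpow_one]
  have h₁ : qnorm 𝕜 f ^ p ≤ (qnorm 𝕜 f + qnorm 𝕜 g) ^ p :=
    Real.rpow_le_rpow hf (by linarith) hp.le
  have h₂ : qnorm 𝕜 g ^ p ≤ (qnorm 𝕜 f + qnorm 𝕜 g) ^ p :=
    Real.rpow_le_rpow hg (by linarith) hp.le
  linarith [h f g]

theorem exists_qnorm_sub_lt {s : Set X} (hs : Dense s) (f : X) {r : ℝ} (hr : 0 < r) :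
    ∃ g ∈ s, qnorm 𝕜 (f - g) < r := by
  have h : {g : X | qnorm 𝕜 (f - g) < r} ∈ 𝓝 f := by
    have h₀ : {g : X | qnorm 𝕜 g < r} ∈ 𝓝 (f - f) := by
      rw [sub_self]; exact (nhds_zero_basis (𝕜 := 𝕜)).mem_of_mem hr
    exact (continuous_const.sub continuous_id).tendsto f h₀
  obtain ⟨g, hg, hgs⟩ := mem_closure_iff_nhds.1 (hs f) _ h
  exact ⟨g, hgs, hg⟩

end PBanachSpace

open PBanachSpace

namespace FundamentalMinimalSystem

variable {𝕜 : Type} [RCLike 𝕜] {X : Type u} [AddCommGroup X] [Module 𝕜 X]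
  [UniformSpace X] [IsUniformAddGroup X] [PBanachSpace 𝕜 X] (S : FundamentalMinimalSystem 𝕜 X)

theorem exists_bound_vec : ∃ C : ℝ, 0 < C ∧ ∀ n, qnorm 𝕜 (S.vec n) ≤ C := by
  obtain ⟨C, hC⟩ := S.bounded_vec
  exact ⟨max C 1, by positivity, fun n => (hC n).trans (le_max_left _ _)⟩

theorem exists_bound_dual : ∃ C : ℝ, 0 < C ∧ ∀ n f, ‖S.dual n f‖ ≤ C * qnorm 𝕜 f := by
  obtain ⟨C, hC⟩ := S.bounded_dual
  exact ⟨max C 1, by positivity, fun n f => (hC n f).trans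
    (mul_le_mul_of_nonneg_right (le_max_left _ _) (qnorm_nonneg _))⟩

theorem dual_sum (a : ℕ → 𝕜) (A : Finset ℕ) (n : ℕ) :
    S.dual n (∑ k ∈ A, a k • S.vec k) = if n ∈ A then a n else 0 := by
  simp [map_sum, S.biorthogonal]

theorem dual_signedSum (ε : ℕ → 𝕜) (A : Finset ℕ) (n : ℕ) :
    S.dual n (S.signedSum ε A) = if n ∈ A then ε n else 0 :=
  S.dual_sum ε A n

theorem dual_proj (A : Finset ℕ) (f : X) (n : ℕ) :
    S.dual n (S.proj A f) = if n ∈ A then S.dual n f else 0 :=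
  S.dual_sum (fun k => S.dual k f) A n

theorem vec_ne_zero (n : ℕ) : S.vec n ≠ 0 := fun h => by
  simpa [h] using S.biorthogonal n n

theorem eventually_dual_eq_zero {g : X}
    (hg : g ∈ Submodule.span 𝕜 (Set.range S.vec)) : ∀ᶠ n in Filter.atTop, S.dual n g = 0 := by
  induction hg using Submodule.span_induction with
  | mem x hx =>
    obtain ⟨k, rfl⟩ := hx
    filter_upwards [Filter.eventually_gt_atTop k] with n hn
    rw [S.biorthogonal, if_neg hn.ne']
  | zero => simp
  | add x y _ _ hx hy => filter_upwards [hx, hy] with n h₁ h₂; simp [h₁, h₂]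
  | smul a x _ hx => filter_upwards [hx] with n h; simp [h]

theorem tendsto_dual (f : X) : Filter.Tendsto (fun n => S.dual n f) Filter.atTop (𝓝 0) := by
  obtain ⟨C, hC, hd⟩ := S.exists_bound_dual
  rw [Metric.tendsto_nhds]
  intro r hr
  obtain ⟨g, hg, hfg⟩ := exists_qnorm_sub_lt (𝕜 := 𝕜) S.dense_span f (div_pos hr hC)
  filter_upwards [S.eventually_dual_eq_zero hg] with n hn
  have h := hd n (f - g)
  rw [map_sub, hn, sub_zero] at h
  rw [dist_zero_right]
  calc _ ≤ _ := h
    _ < C * (r / C) := by gcongr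
    _ = r := by field_simp

/-- Far out there are arbitrarily large finite sets on which `f` is negligible. -/
theorem exists_far_set (f : X) (m N : ℕ) :
    ∃ D : Finset ℕ, D.card = m ∧ (∀ n ∈ D, N ≤ n) ∧ qnorm 𝕜 (S.proj D f) ≤ qnorm 𝕜 f := by
  rcases eq_or_ne f 0 with rfl | hf
  · exact ⟨Finset.Ico N (N + m), by simp, fun n hn => (Finset.mem_Ico.1 hn).1, by simp [proj]⟩
  obtain ⟨p, hp, -, h⟩ := exists_subadditive (𝕜 := 𝕜) (X := X)
  obtain ⟨C, hC, hv⟩ := S.exists_bound_vec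
  have hr : 0 < qnorm 𝕜 f ^ p / (m + 1) :=
    div_pos (Real.rpow_pos_of_pos (qnorm_pos hf) _) (by positivity)
  have ht : Filter.Tendsto (fun n => (‖S.dual n f‖ * C) ^ p) Filter.atTop (𝓝 0) := by
    have := (((S.tendsto_dual f).norm.mul_const C).rpow_const (p := p) (Or.inr hp.le))
    simpa [Real.zero_rpow hp.ne'] using this
  obtain ⟨N', hN'⟩ := Filter.eventually_atTop.1 (ht.eventually_lt_const hr)
  refine ⟨Finset.Ico (max N N') (max N N' + m), by simp,
    fun n hn => (le_max_left _ _).trans (Finset.mem_Ico.1 hn).1, ?_⟩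
  set D := Finset.Ico (max N N') (max N N' + m)
  rw [← Real.rpow_le_rpow_iff (qnorm_nonneg _) (qnorm_nonneg _) hp]
  calc qnorm 𝕜 (S.proj D f) ^ p ≤ ∑ n ∈ D, qnorm 𝕜 (S.dual n f • S.vec n) ^ p :=
        Finset.le_sum_of_subadditive (fun x : X => qnorm 𝕜 x ^ p)
          (by simp [qnorm_zero, Real.zero_rpow hp.ne']) h _ _
    _ ≤ ∑ n ∈ D, qnorm 𝕜 f ^ p / (m + 1) := by
        refine Finset.sum_le_sum fun n hn => ?_
        refine le_trans ?_ (hN' n ((le_max_right _ _).trans (Finset.mem_Ico.1 hn).1)).le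
        refine Real.rpow_le_rpow (qnorm_nonneg _) ?_ hp.le
        rw [qnorm_smul]
        exact mul_le_mul_of_nonneg_left (hv n) (norm_nonneg _)
    _ = m * (qnorm 𝕜 f ^ p / (m + 1)) := by simp [D]
    _ ≤ qnorm 𝕜 f ^ p := by
        have : 0 ≤ qnorm 𝕜 f ^ p := Real.rpow_nonneg (qnorm_nonneg _) _
        rw [mul_div_assoc', div_le_iff₀ (by positivity)]
        nlinarith

theorem IsGreedySet.exists_subset {S : FundamentalMinimalSystem 𝕜 X} {f : X} {B : Finset ℕ} (hB : S.IsGreedySet f B) {k : ℕ}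
    (hk : k ≤ B.card) : ∃ B' ⊆ B, B'.card = k ∧ S.IsGreedySet f B' := by
  obtain ⟨d, hd⟩ := Nat.exists_eq_add_of_le hk
  induction d generalizing B with
  | zero => exact ⟨B, subset_rfl, hd, hB⟩
  | succ d ih =>
    obtain ⟨b, hb, hmin⟩ := B.exists_min_image (fun n => ‖S.dual n f‖)
      (Finset.card_pos.1 (by omega))
    have hc := Finset.card_erase_of_mem hb
    have hg : S.IsGreedySet f (B.erase b) := by
      intro n hn j hj
      have hnB := Finset.mem_of_mem_erase hn
      by_cases hjB : j ∈ B
      · obtain rfl : j = b := by simpa [hjB] using hj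
        exact hmin n hnB
      · exact hB n hnB j hjB
    obtain ⟨B', h₁, h₂, h₃⟩ := ih hg (by omega) (by omega)
    exact ⟨B', h₁.trans (Finset.erase_subset _ _), h₂, h₃⟩

theorem exists_balanced_cut (A : Finset ℕ) (B : Finset ℕ) :
    ∃ N, B.card ≤ (A.filter (· < N)).card + (B.filter (· < N)).card ∧
      (A.filter (· < N)).card + (B.filter (· < N)).card ≤ B.card + 1 := by
  have hex : ∃ N, B.card ≤ (A.filter (· < N)).card + (B.filter (· < N)).card := by
    refine ⟨B.sup id + 1, ?_⟩
    rw [Finset.filter_true_of_mem (s := B)]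
    · exact Nat.le_add_left _ _
    · exact fun n hn => Nat.lt_succ_of_le (Finset.le_sup (f := id) hn)
  refine ⟨Nat.find hex, Nat.find_spec hex, ?_⟩
  cases h : Nat.find hex with
  | zero => simp
  | succ N =>
    have hN := Nat.find_min hex (m := N) (by omega)
    have hstep : ∀ D : Finset ℕ, (D.filter (· < N + 1)).card ≤ (D.filter (· < N)).card + 1 := by
      intro D
      refine (Finset.card_le_card ?_).trans (Finset.card_insert_le N _)
      intro n hn
      simp only [Finset.mem_filter, Finset.mem_insert] at hn ⊢
      exact (Nat.lt_succ_iff_lt_or_eq.1 hn.2).elim (fun h => Or.inr ⟨hn.1, h⟩) Or.inl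
    have := hstep A
    have := hstep B
    omega

theorem le_of_sInf_eq {s : Set ℝ≥0∞} {L a b : ℝ} (hs : sInf s = ENNReal.ofReal L) (hL : 0 ≤ L)
    (hb : 0 ≤ b) (h₀ : b = 0 → a ≤ 0)
    (h : ∀ C ∈ s, ENNReal.ofReal a ≤ C * ENNReal.ofReal b) : a ≤ L * b := by
  rcases hb.eq_or_lt with rfl | hb
  · simpa using h₀ rfl
  rw [← div_le_iff₀ hb, ← ENNReal.ofReal_le_ofReal_iff hL, ← hs]
  refine le_sInf fun C hC => ?_
  rw [ENNReal.ofReal_div_of_pos hb]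
  exact ENNReal.div_le_of_le_mul (h C hC)

theorem le_of_squeezeSymmetry {m : ℕ} {L : ℝ} (hL : squeezeSymmetry 𝕜 X S m = ENNReal.ofReal L)
    (hL₀ : 0 ≤ L) {f : X} {A B : Finset ℕ} {ε : ℕ → 𝕜} {t : ℝ} (hB : S.IsGreedySet f B)
    (hcard : A.card = B.card) (hm : B.card ≤ m) (hε : IsSignOn ε A)
    (ht : ∀ n ∈ B, t ≤ ‖S.dual n f‖) (hne : B.Nonempty) :
    t * qnorm 𝕜 (S.signedSum ε A) ≤ L * qnorm 𝕜 f := by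
  have htB : t ≤ B.inf' hne fun n => ‖S.dual n f‖ := (Finset.le_inf'_iff _ _).2 ht
  refine (mul_le_mul_of_nonneg_right htB (qnorm_nonneg _)).trans ?_
  refine le_of_sInf_eq hL hL₀ (qnorm_nonneg _) (fun h => ?_)
    (fun C hC => hC f A B hne ε hB hcard.symm (hcard.le.trans hm) hε)
  rw [qnorm_eq_zero_iff] at h
  simp [h]

theorem le_of_disjointSqueezeSymmetry {m : ℕ} {L : ℝ}
    (hL : disjointSqueezeSymmetry 𝕜 X S m = ENNReal.ofReal L)
    (hL₀ : 0 ≤ L) {f : X} {A B : Finset ℕ} {ε : ℕ → 𝕜} {t : ℝ} (hB : S.IsGreedySet f B)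
    (hcard : A.card ≤ B.card) (hm : B.card ≤ m) (hε : IsSignOn ε A)
    (hd : Disjoint (A : Set ℕ) (S.supp f)) (ht : ∀ n ∈ B, t ≤ ‖S.dual n f‖) :
    t * qnorm 𝕜 (S.signedSum ε A) ≤ L * qnorm 𝕜 f := by
  rcases A.eq_empty_or_nonempty with rfl | hA
  · simpa [signedSum, qnorm_zero] using mul_nonneg hL₀ (qnorm_nonneg (𝕜 := 𝕜) f)
  obtain ⟨B', hBB, hB', hg⟩ := hB.exists_subset hcard
  have hne : B'.Nonempty := Finset.card_pos.1 (hB' ▸ Finset.card_pos.2 hA)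
  have htB : t ≤ B'.inf' hne fun n => ‖S.dual n f‖ :=
    (Finset.le_inf'_iff _ _).2 fun n hn => ht n (hBB hn)
  refine (mul_le_mul_of_nonneg_right htB (qnorm_nonneg _)).trans ?_
  refine le_of_sInf_eq hL hL₀ (qnorm_nonneg _) (fun h => ?_)
    (fun C hC => hC f A B' hne ε hg hB' (hcard.trans hm) hε hd)
  rw [qnorm_eq_zero_iff] at h
  simp [h]

theorem squeezeSymmetry_le_of_forall {m : ℕ} {C : ℝ} (hC : 0 ≤ C)
    (h : ∀ (f : X) (A B : Finset ℕ) (ε : ℕ → 𝕜) (t : ℝ), 0 ≤ t → B.Nonempty → S.IsGreedySet f B →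
      B.card = A.card → A.card ≤ m → IsSignOn ε A → (∀ n ∈ B, t ≤ ‖S.dual n f‖) →
      t * qnorm 𝕜 (S.signedSum ε A) ≤ C * qnorm 𝕜 f) :
    squeezeSymmetry 𝕜 X S m ≤ ENNReal.ofReal C := by
  refine sInf_le fun f A B hB ε hg hc hm hε => ?_
  rw [← ENNReal.ofReal_mul hC]
  exact ENNReal.ofReal_le_ofReal (h f A B ε _ ((Finset.le_inf'_iff _ _).2 fun _ _ => norm_nonneg _)
    hB hg hc hm hε fun n hn => Finset.inf'_le _ hn)

theorem disjointSqueezeSymmetry_le_of_forall {m : ℕ} {C : ℝ} (hC : 0 ≤ C)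
    (h : ∀ (f : X) (A B : Finset ℕ) (ε : ℕ → 𝕜) (t : ℝ), 0 ≤ t → B.Nonempty → S.IsGreedySet f B →
      B.card = A.card → A.card ≤ m → IsSignOn ε A → Disjoint (A : Set ℕ) (S.supp f) →
      (∀ n ∈ B, t ≤ ‖S.dual n f‖) →
      t * qnorm 𝕜 (S.signedSum ε A) ≤ C * qnorm 𝕜 f) :
    disjointSqueezeSymmetry 𝕜 X S m ≤ ENNReal.ofReal C := by
  refine sInf_le fun f A B hB ε hg hc hm hε hd => ?_
  rw [← ENNReal.ofReal_mul hC]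
  exact ENNReal.ofReal_le_ofReal (h f A B ε _ ((Finset.le_inf'_iff _ _).2 fun _ _ => norm_nonneg _)
    hB hg hc hm hε hd fun n hn => Finset.inf'_le _ hn)

theorem disjointSqueezeSymmetry_le_squeezeSymmetry (m : ℕ) :
    disjointSqueezeSymmetry 𝕜 X S m ≤ squeezeSymmetry 𝕜 X S m :=
  sInf_le_sInf fun _ hC f A B hB ε hg hc hm hε _ => hC f A B hB ε hg hc hm hε

theorem isGreedySet_signedSum (δ : ℕ → 𝕜) (B : Finset ℕ) :
    S.IsGreedySet (S.signedSum δ B) B := by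
  intro n hn k hk
  simp [dual_signedSum, hn, hk]

theorem one_le_disjointSqueezeSymmetry {m : ℕ} (hm : 1 ≤ m) :
    1 ≤ disjointSqueezeSymmetry 𝕜 X S m := by
  refine le_sInf fun C hC => ?_
  have key : ∀ i j : ℕ, i ≠ j →
      ENNReal.ofReal (qnorm 𝕜 (S.vec i)) ≤ C * ENNReal.ofReal (qnorm 𝕜 (S.vec j)) := by
    intro i j hij
    have hg : S.IsGreedySet (S.vec j) {j} := by
      simpa [signedSum] using
        S.isGreedySet_signedSum (fun _ => (1 : 𝕜)) {j}
    have := hC (S.vec j) {i} {j} (Finset.singleton_nonempty j) (fun _ => 1) hg (by simp)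
      (by simpa using hm) (by simp [IsSignOn])
      (by simpa [supp, S.biorthogonal, eq_comm] using hij)
    simpa [S.biorthogonal, signedSum] using this
  by_contra! hC1
  have h0 : ENNReal.ofReal (qnorm 𝕜 (S.vec 0)) ≠ 0 := by
    simpa using qnorm_pos (𝕜 := 𝕜) (S.vec_ne_zero 0)
  have h1 : ENNReal.ofReal (qnorm 𝕜 (S.vec 1)) ≠ 0 := by
    simpa using qnorm_pos (𝕜 := 𝕜) (S.vec_ne_zero 1)
  have hlt : ∀ x : ℝ≥0∞, x ≠ 0 → x ≠ ⊤ → C * x < x := fun x hx hx' => by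
    simpa using ENNReal.mul_lt_mul_left hx hx' hC1
  exact lt_irrefl _ (((key 0 1 zero_ne_one).trans_lt (hlt _ h1 ENNReal.ofReal_ne_top)).trans_le
    ((key 1 0 one_ne_zero).trans (hlt _ h0 ENNReal.ofReal_ne_top).le))

theorem exists_eq_ofReal_of_one_le {x : ℝ≥0∞} (h₁ : 1 ≤ x) (h : x ≠ ⊤) :
    ∃ L : ℝ, 1 ≤ L ∧ x = ENNReal.ofReal L := by
  refine ⟨x.toReal, ?_, (ENNReal.ofReal_toReal h).symm⟩
  simpa using ENNReal.toReal_mono h h₁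

theorem exists_squeezeSymmetry_le_sq :
    ∃ C : ℝ≥0, 1 ≤ C ∧ ∀ m, 1 ≤ m →
      squeezeSymmetry 𝕜 X S m ≤ C * disjointSqueezeSymmetry 𝕜 X S m ^ (2 : ℝ) := by
  obtain ⟨K, hK, hadd⟩ := exists_qnorm_add_le 𝕜 X
  refine ⟨(2 * K).toNNReal, by simpa using by linarith, fun m hm => ?_⟩
  by_cases htop : disjointSqueezeSymmetry 𝕜 X S m = ⊤
  · rw [htop, ENNReal.top_rpow_of_pos two_pos, ENNReal.mul_top]
    · exact le_top
    · simpa using by linarith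
  obtain ⟨L, hL₁, hL⟩ := exists_eq_ofReal_of_one_le (S.one_le_disjointSqueezeSymmetry hm) htop
  have hL₀ : 0 ≤ L := by linarith
  have hK₀ : 0 ≤ K := by linarith
  rw [hL, ENNReal.ofReal_rpow_of_nonneg hL₀ zero_le_two]
  change _ ≤ ENNReal.ofReal (2 * K) * _
  rw [← ENNReal.ofReal_mul (by positivity), Real.rpow_two]
  refine S.squeezeSymmetry_le_of_forall (by positivity) fun f A B ε t ht₀ hne hB hc hm hε ht => ?_
  obtain ⟨D, hD, hDfar, hDf⟩ := S.exists_far_set f B.card (max (A.sup id) (B.sup id) + 1)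
  have hDA : Disjoint A D := Finset.disjoint_left.2 fun n hn hn' => by
    have h₁ := Finset.le_sup (f := id) hn
    have h₂ := hDfar n hn'
    have := le_max_left (A.sup id) (B.sup id)
    simp only [id] at *
    omega
  have hDB : Disjoint B D := Finset.disjoint_left.2 fun n hn hn' => by
    have h₁ := Finset.le_sup (f := id) hn
    have h₂ := hDfar n hn'
    have := le_max_right (A.sup id) (B.sup id)
    simp only [id] at *
    omega
  set g := f + -S.proj D f with hg
  have hdual : ∀ n, S.dual n g = if n ∈ D then 0 else S.dual n f := fun n => by
    rw [hg, map_add, map_neg, dual_proj]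
    split_ifs <;> simp
  have hdualB : ∀ n ∈ B, S.dual n g = S.dual n f := fun n hn => by
    rw [hdual, if_neg (Finset.disjoint_left.1 hDB hn)]
  have hgB : S.IsGreedySet g B := fun n hn k hk => by
    rw [hdualB n hn, hdual]
    split_ifs
    · simp
    · exact hB n hn k hk
  have h₁ : t * qnorm 𝕜 (S.signedSum (fun _ => (1 : 𝕜)) D) ≤ L * qnorm 𝕜 g := by
    refine S.le_of_disjointSqueezeSymmetry hL hL₀ hgB hD.le (hc ▸ hm) (by simp [IsSignOn]) ?_ ?_
    · rw [Set.disjoint_left]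
      intro n hn
      simp [supp, hdual, Finset.mem_coe.1 hn]
    · intro n hn
      rw [hdualB n hn]
      exact ht n hn
  have h₂ : 1 * qnorm 𝕜 (S.signedSum ε A) ≤ L * qnorm 𝕜 (S.signedSum (fun _ => (1 : 𝕜)) D) := by
    refine S.le_of_disjointSqueezeSymmetry hL hL₀ (S.isGreedySet_signedSum _ _)
      (hc ▸ hD.ge) (by omega) hε ?_ ?_
    · rw [Set.disjoint_left]
      intro n hn
      simp [supp, dual_signedSum, Finset.disjoint_left.1 hDA (Finset.mem_coe.1 hn)]
    · intro n hn
      simp [dual_signedSum, hn]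
  have h₃ : qnorm 𝕜 g ≤ 2 * K * qnorm 𝕜 f := by
    refine (hadd _ _).trans ?_
    rw [qnorm_neg]
    nlinarith [qnorm_nonneg (𝕜 := 𝕜) f]
  calc t * qnorm 𝕜 (S.signedSum ε A)
      ≤ t * (L * qnorm 𝕜 (S.signedSum (fun _ => (1 : 𝕜)) D)) := by gcongr; linarith
    _ = L * (t * qnorm 𝕜 (S.signedSum (fun _ => (1 : 𝕜)) D)) := by ring
    _ ≤ L * (L * qnorm 𝕜 g) := by gcongr
    _ ≤ L * (L * (2 * K * qnorm 𝕜 f)) := by gcongr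
    _ = _ := by ring

theorem democracy_le_superDemocracy (m : ℕ) :
    democracy 𝕜 X S m ≤ superDemocracy 𝕜 X S m := by
  refine iSup_le fun A => iSup_le fun B => iSup_le fun hc => iSup_le fun hm => ?_
  refine le_iSup_of_le A <| le_iSup_of_le B <| le_iSup_of_le 1 <| le_iSup_of_le 1 <|
    le_iSup_of_le hc <| le_iSup_of_le hm <| le_iSup_of_le (by simp [IsSignOn]) <|
    le_iSup_of_le (by simp [IsSignOn]) ?_
  simp [signedSum, indicatorSum]

theorem superDemocracy_le_symmetryLargest (m : ℕ) :
    superDemocracy 𝕜 X S m ≤ symmetryLargest 𝕜 X S m := by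
  refine iSup_le fun A => iSup_le fun B => iSup_le fun ε => iSup_le fun δ => iSup_le fun hc =>
    iSup_le fun hm => iSup_le fun hε => iSup_le fun hδ => ?_
  refine le_iSup_of_le A <| le_iSup_of_le B <| le_iSup_of_le ε <| le_iSup_of_le δ <|
    le_iSup_of_le 0 <| le_iSup_of_le hc <| le_iSup_of_le hm <| le_iSup_of_le hε <|
    le_iSup_of_le hδ <| le_iSup_of_le (by simp) <| le_iSup_of_le (by simp [supp]) ?_
  simp

theorem superDemocracy_le_squeezeSymmetry (m : ℕ) :
    superDemocracy 𝕜 X S m ≤ squeezeSymmetry 𝕜 X S m := by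
  refine iSup_le fun A => iSup_le fun B => iSup_le fun ε => iSup_le fun δ => iSup_le fun hc =>
    iSup_le fun hm => iSup_le fun hε => iSup_le fun hδ => ?_
  rcases B.eq_empty_or_nonempty with rfl | hB
  · simp only [Finset.card_empty, Finset.card_eq_zero] at hc
    simp [hc, signedSum, qnorm_zero]
  obtain ⟨b, hb⟩ := hB
  have hpos : 0 < qnorm 𝕜 (S.signedSum δ B) := qnorm_pos fun h => by
    have h₁ := S.dual_signedSum δ B b
    have h₂ := hδ b hb
    rw [h, if_pos hb, map_zero] at h₁
    simp [← h₁] at h₂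
  refine le_sInf fun C hC => ?_
  rw [ENNReal.ofReal_div_of_pos hpos]
  refine ENNReal.div_le_of_le_mul (le_trans ?_ (hC (S.signedSum δ B) A B ⟨b, hb⟩ ε
    (S.isGreedySet_signedSum _ _) hc.symm (hc ▸ hm) hε))
  refine ENNReal.ofReal_le_ofReal (le_mul_of_one_le_left (qnorm_nonneg _) ?_)
  refine (Finset.le_inf'_iff _ _).2 fun n hn => ?_
  rw [dual_signedSum, if_pos hn, hδ n hn]

theorem exists_symmetryLargest_le :
    ∃ C : ℝ≥0, 1 ≤ C ∧ ∀ m, 1 ≤ m →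
      symmetryLargest 𝕜 X S m ≤ C * squeezeSymmetry 𝕜 X S m := by
  obtain ⟨K, hK, hadd⟩ := exists_qnorm_add_le 𝕜 X
  have hK₂ : 1 ≤ 3 * K ^ 2 := by nlinarith
  refine ⟨(3 * K ^ 2).toNNReal, by simpa using hK₂, fun m hm => ?_⟩
  by_cases htop : squeezeSymmetry 𝕜 X S m = ⊤
  · rw [htop, ENNReal.mul_top]
    · exact le_top
    · simpa using by linarith
  obtain ⟨L, hL₁, hL⟩ := exists_eq_ofReal_of_one_le ((S.one_le_disjointSqueezeSymmetry hm).trans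
    (S.disjointSqueezeSymmetry_le_squeezeSymmetry m)) htop
  have hL₀ : 0 ≤ L := by linarith
  have hK₀ : 0 ≤ K := by linarith
  rw [hL]
  change _ ≤ ENNReal.ofReal (3 * K ^ 2) * _
  rw [← ENNReal.ofReal_mul (by positivity)]
  refine iSup_le fun A => iSup_le fun B => iSup_le fun ε => iSup_le fun δ => iSup_le fun f =>
    iSup_le fun hc => iSup_le fun hm => iSup_le fun hε => iSup_le fun hδ => iSup_le fun hf =>
    iSup_le fun hd => ?_
  refine ENNReal.ofReal_le_ofReal (div_le_of_le_mul₀ (qnorm_nonneg _) (by positivity) ?_)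
  set g := S.signedSum δ B + f with hg
  rcases B.eq_empty_or_nonempty with rfl | hB
  · simp only [Finset.card_empty, Finset.card_eq_zero] at hc
    subst hc
    simp only [hg, signedSum, Finset.sum_empty]
    exact le_mul_of_one_le_left (qnorm_nonneg _) (by nlinarith)
  have hgB : ∀ n ∈ B, ‖S.dual n g‖ = 1 := fun n hn => by
    have : S.dual n f = 0 := by
      by_contra h
      exact Set.disjoint_left.1 hd h (Or.inr hn)
    simp [hg, dual_signedSum, hn, hδ n hn, this]
  have hgr : S.IsGreedySet g B := fun n hn k hk => by
    rw [hgB n hn]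
    simpa [hg, dual_signedSum, hk] using hf k
  have h₁ : 1 * qnorm 𝕜 (S.signedSum ε A) ≤ L * qnorm 𝕜 g :=
    S.le_of_squeezeSymmetry hL hL₀ hgr hc hm hε (fun n hn => (hgB n hn).ge) hB
  have h₂ : 1 * qnorm 𝕜 (S.signedSum δ B) ≤ L * qnorm 𝕜 g :=
    S.le_of_squeezeSymmetry hL hL₀ hgr rfl hm hδ (fun n hn => (hgB n hn).ge) hB
  have hg₀ := qnorm_nonneg (𝕜 := 𝕜) g
  calc qnorm 𝕜 (S.signedSum ε A + f)
      = qnorm 𝕜 (g + (S.signedSum ε A + -S.signedSum δ B)) := by congr 1; rw [hg]; abel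
    _ ≤ K * (qnorm 𝕜 g + K * (qnorm 𝕜 (S.signedSum ε A) + qnorm 𝕜 (S.signedSum δ B))) := by
        refine (hadd _ _).trans ?_
        gcongr
        simpa [qnorm_neg] using hadd (S.signedSum ε A) (-S.signedSum δ B)
    _ ≤ K * (qnorm 𝕜 g + K * (L * qnorm 𝕜 g + L * qnorm 𝕜 g)) := by gcongr <;> linarith
    _ ≤ K * (K * (L * qnorm 𝕜 g) + K * (L * qnorm 𝕜 g + L * qnorm 𝕜 g)) := by
        gcongr
        exact (le_mul_of_one_le_left hg₀ hL₁).trans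
          (le_mul_of_one_le_left (by positivity) hK)
    _ = _ := by ring

theorem signedSum_add_of_disjoint (ε : ℕ → 𝕜) {A A' : Finset ℕ} (h : Disjoint A A') :
    S.signedSum ε (A ∪ A') = S.signedSum ε A + S.signedSum ε A' :=
  Finset.sum_union h

/-- For Schauder bases the disjoint squeeze symmetry parameter controls the unrestricted one:
cut `f` at a point `N` and test the part of `A` on each side against the part of `f` on the other
side. -/
theorem IsSchauder.exists_squeezeSymmetry_le {S : FundamentalMinimalSystem 𝕜 X}
    (hS : S.IsSchauder) :
    ∃ C : ℝ≥0, 1 ≤ C ∧ ∀ m, 1 ≤ m →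
      squeezeSymmetry 𝕜 X S m ≤ C * disjointSqueezeSymmetry 𝕜 X S m := by
  obtain ⟨K, hK, hadd⟩ := exists_qnorm_add_le 𝕜 X
  obtain ⟨Cv, hCv, hv⟩ := S.exists_bound_vec
  obtain ⟨Cd, hCd, hd⟩ := S.exists_bound_dual
  obtain ⟨P', hP'⟩ := hS.2
  obtain ⟨P, hP₀, hP⟩ : ∃ P : ℝ, 0 ≤ P ∧ ∀ (m : ℕ) (f : X),
      qnorm 𝕜 (S.proj (Finset.range m) f) ≤ P * qnorm 𝕜 f :=
    ⟨max P' 0, le_max_right _ _, fun m f => (hP' m f).trans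
      (mul_le_mul_of_nonneg_right (le_max_left _ _) (qnorm_nonneg _))⟩
  have hK₀ : 0 ≤ K := by linarith
  set C := K * (P + K * (K * (1 + P) + Cv * Cd)) + 1 with hC
  have hC₁ : 1 ≤ C := by
    have : 0 ≤ K * (P + K * (K * (1 + P) + Cv * Cd)) := by positivity
    linarith
  refine ⟨C.toNNReal, by simpa using hC₁, fun m hm => ?_⟩
  by_cases htop : disjointSqueezeSymmetry 𝕜 X S m = ⊤
  · rw [htop, ENNReal.mul_top]
    · exact le_top
    · simpa using by linarith
  obtain ⟨L, hL₁, hL⟩ := exists_eq_ofReal_of_one_le (S.one_le_disjointSqueezeSymmetry hm) htop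
  have hL₀ : 0 ≤ L := by linarith
  rw [hL]
  change _ ≤ ENNReal.ofReal C * _
  rw [← ENNReal.ofReal_mul (by positivity)]
  refine S.squeezeSymmetry_le_of_forall (by positivity) fun f A B ε t ht₀ hne hB hc hm hε ht => ?_
  obtain ⟨N, hN₁, hN₂⟩ := exists_balanced_cut A B
  have hAN := Finset.card_filter_add_card_filter_not (s := A) (· < N)
  have hBN := Finset.card_filter_add_card_filter_not (s := B) (· < N)
  set f₁ := S.proj (Finset.range N) f with hf₁
  set f₂ := f + -f₁ with hf₂
  have hd₁ : ∀ n, S.dual n f₁ = if n < N then S.dual n f else 0 := fun n => by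
    rw [hf₁, dual_proj]; simp
  have hd₂ : ∀ n, S.dual n f₂ = if n < N then 0 else S.dual n f := fun n => by
    rw [hf₂, map_add, map_neg, hd₁]; split_ifs <;> simp
  have hq := qnorm_nonneg (𝕜 := 𝕜) f
  have hq₁ : qnorm 𝕜 f₁ ≤ P * qnorm 𝕜 f := hP N f
  have hq₂ : qnorm 𝕜 f₂ ≤ K * (1 + P) * qnorm 𝕜 f := by
    refine (hadd _ _).trans ?_
    rw [qnorm_neg, mul_assoc]
    gcongr
    linarith
  have hg₁ : S.IsGreedySet f₁ (B.filter (· < N)) := fun n hn k hk => by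
    simp only [Finset.mem_filter] at hn hk
    rw [hd₁, hd₁, if_pos hn.2]
    split_ifs with h
    · exact hB n hn.1 k fun h' => hk ⟨h', h⟩
    · simp
  have hg₂ : S.IsGreedySet f₂ (B.filter (¬ · < N)) := fun n hn k hk => by
    simp only [Finset.mem_filter] at hn hk
    rw [hd₂, hd₂, if_neg hn.2]
    split_ifs with h
    · simp
    · exact hB n hn.1 k fun h' => hk ⟨h', h⟩
  have h₁ : t * qnorm 𝕜 (S.signedSum ε (A.filter (¬ · < N))) ≤ L * qnorm 𝕜 f₁ := by
    refine S.le_of_disjointSqueezeSymmetry hL hL₀ hg₁ (by omega) (by omega)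
      (fun n hn => hε n (Finset.mem_of_mem_filter n hn)) ?_ ?_
    · rw [Set.disjoint_left]
      intro n hn
      have := (Finset.mem_filter.1 (Finset.mem_coe.1 hn)).2
      simp [supp, hd₁, this]
    · intro n hn
      rw [Finset.mem_filter] at hn
      simpa [hd₁, hn.2] using ht n hn.1
  have hcore : ∀ A' ⊆ A.filter (· < N), A'.card ≤ (B.filter (¬ · < N)).card →
      t * qnorm 𝕜 (S.signedSum ε A') ≤ L * qnorm 𝕜 f₂ := by
    intro A' hA' hcA
    refine S.le_of_disjointSqueezeSymmetry hL hL₀ hg₂ hcA (by omega)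
      (fun n hn => hε n (Finset.mem_of_mem_filter n (hA' hn))) ?_ ?_
    · rw [Set.disjoint_left]
      intro n hn
      have := (Finset.mem_filter.1 (hA' (Finset.mem_coe.1 hn))).2
      simp [supp, hd₂, this]
    · intro n hn
      rw [Finset.mem_filter] at hn
      simpa [hd₂, hn.2] using ht n hn.1
  obtain ⟨b, hb⟩ := hne
  have htf : t ≤ Cd * qnorm 𝕜 f := (ht b hb).trans (hd b f)
  have h₂ : t * qnorm 𝕜 (S.signedSum ε (A.filter (· < N))) ≤
      K * (L * qnorm 𝕜 f₂ + Cv * Cd * qnorm 𝕜 f) := by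
    obtain ⟨A', hA', hcA'⟩ := Finset.exists_subset_card_eq
      (Nat.sub_le (A.filter (· < N)).card 1)
    have h₃ := hcore A' hA' (by omega)
    have hrest : ((A.filter (· < N)) \ A').card ≤ 1 := by
      rw [Finset.card_sdiff_of_subset hA']; omega
    have h₄ : t * qnorm 𝕜 (S.signedSum ε (A.filter (· < N) \ A')) ≤ Cv * Cd * qnorm 𝕜 f := by
      have hnn : 0 ≤ Cv * Cd * qnorm 𝕜 f := by positivity
      rcases Finset.card_le_one_iff_subset_singleton.1 hrest with ⟨a, ha⟩
      rcases Finset.subset_singleton_iff.1 ha with h | h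
      · simpa [h, signedSum, qnorm_zero] using hnn
      · have haA : a ∈ A := by
          have : a ∈ A.filter (· < N) \ A' := by simp [h]
          exact Finset.mem_of_mem_filter a (Finset.mem_sdiff.1 this).1
        rw [h]
        simp only [signedSum, Finset.sum_singleton, qnorm_smul, hε a haA, one_mul]
        calc t * qnorm 𝕜 (S.vec a) ≤ (Cd * qnorm 𝕜 f) * Cv :=
              mul_le_mul htf (hv a) (qnorm_nonneg _) (by positivity)
          _ = _ := by ring
    have hsplit : S.signedSum ε (A.filter (· < N)) =
        S.signedSum ε A' + S.signedSum ε (A.filter (· < N) \ A') := by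
      rw [← signedSum_add_of_disjoint S ε Finset.disjoint_sdiff, Finset.union_sdiff_of_subset hA']
    rw [hsplit]
    calc _ ≤ t * (K * (qnorm 𝕜 (S.signedSum ε A') +
            qnorm 𝕜 (S.signedSum ε (A.filter (· < N) \ A')))) := by gcongr; exact hadd _ _
      _ = K * (t * qnorm 𝕜 (S.signedSum ε A') +
            t * qnorm 𝕜 (S.signedSum ε (A.filter (· < N) \ A'))) := by ring
      _ ≤ _ := by gcongr
  have hsplit : S.signedSum ε A =
      S.signedSum ε (A.filter (¬ · < N)) + S.signedSum ε (A.filter (· < N)) := by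
    rw [add_comm]
    exact (Finset.sum_filter_add_sum_filter_not A (· < N) fun n => ε n • S.vec n).symm
  rw [hsplit]
  calc _ ≤ t * (K * (qnorm 𝕜 (S.signedSum ε (A.filter (¬ · < N))) +
          qnorm 𝕜 (S.signedSum ε (A.filter (· < N))))) := by gcongr; exact hadd _ _
    _ = K * (t * qnorm 𝕜 (S.signedSum ε (A.filter (¬ · < N))) +
          t * qnorm 𝕜 (S.signedSum ε (A.filter (· < N)))) := by ring
    _ ≤ K * (L * (P * qnorm 𝕜 f) +
          K * (L * (K * (1 + P) * qnorm 𝕜 f) + L * (Cv * Cd * qnorm 𝕜 f))) := by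
        have h₅ : Cv * Cd * qnorm 𝕜 f ≤ L * (Cv * Cd * qnorm 𝕜 f) :=
          le_mul_of_one_le_left (by positivity) hL₁
        have h₆ : L * qnorm 𝕜 f₁ ≤ L * (P * qnorm 𝕜 f) := by gcongr
        have h₇ : L * qnorm 𝕜 f₂ ≤ L * (K * (1 + P) * qnorm 𝕜 f) := by gcongr
        refine mul_le_mul_of_nonneg_left (add_le_add (h₁.trans h₆) (h₂.trans ?_)) hK₀
        exact mul_le_mul_of_nonneg_left (add_le_add h₇ h₅) hK₀
    _ = (C - 1) * L * qnorm 𝕜 f := by rw [hC]; ring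
    _ ≤ C * L * qnorm 𝕜 f := by gcongr; linarith

end FundamentalMinimalSystem

/-- A separable Banach space is a separable `p`-Banach space with `p = 1`. -/
@[reducible]
def PBanachSpace.ofNormedSpace (𝕜 : Type) [RCLike 𝕜] (X : Type u) [NormedAddCommGroup X]
    [NormedSpace 𝕜 X] [CompleteSpace X] [TopologicalSpace.SeparableSpace X] :
    PBanachSpace 𝕜 X where
  qnorm f := ‖f‖
  qnorm_nonneg := norm_nonneg
  qnorm_eq_zero_iff _ := norm_eq_zero
  qnorm_smul := norm_smul
  exists_subadditive := ⟨1, one_pos, le_rfl, fun f g => by simpa using norm_add_le f g⟩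
  nhds_zero_basis := Metric.nhds_basis_ball.congr (fun _ => Iff.rfl) fun _ _ => by ext; simp
  complete := inferInstance
  separable := inferInstance

/-- A family of coefficient functionals, bounded by `1` on the unit vectors and containing the
coordinate functionals. It gives a norm `sup_g |∑ g_n f_n|` on finitely supported sequences. -/
structure NormingFamily (𝕜 : Type) [RCLike 𝕜] where
  /-- the functionals, given by their coefficients -/
  carrier : Set (ℕ →₀ 𝕜)
  norm_le_one : ∀ g ∈ carrier, ∀ n, ‖g n‖ ≤ 1
  single_mem : ∀ n, Finsupp.single n 1 ∈ carrier

namespace NormingFamily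

variable {𝕜 : Type} [RCLike 𝕜] (G : NormingFamily 𝕜)

/-- The unit vectors, represented by their values under all functionals of the family. -/
def unitVec (n : ℕ) : lp (fun _ : ULift.{u} G.carrier => 𝕜) ∞ :=
  ⟨fun g => g.down.1 n, memℓp_infty ⟨1, by
    rintro _ ⟨g, rfl⟩
    exact G.norm_le_one _ g.down.2 n⟩⟩

/-- The closed linear span of the unit vectors. -/
def closedSpan : Submodule 𝕜 (lp (fun _ : ULift.{u} G.carrier => 𝕜) ∞) :=
  (Submodule.span 𝕜 (Set.range G.unitVec)).topologicalClosure

/-- The Banach space with the norm given by the family: the closed linear span of the unit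
vectors. -/
def Space : Type u := G.closedSpan.{u}

instance : NormedAddCommGroup G.Space.{u} := inferInstanceAs (NormedAddCommGroup G.closedSpan.{u})

instance : NormedSpace 𝕜 G.Space.{u} := inferInstanceAs (NormedSpace 𝕜 G.closedSpan.{u})

instance : CompleteSpace G.Space.{u} :=
  (Submodule.isClosed_topologicalClosure _).completeSpace_coe

instance : TopologicalSpace.SeparableSpace G.Space.{u} :=
  (((Set.countable_range G.unitVec.{u}).isSeparable.span (R := 𝕜)).closure).separableSpace

instance : PBanachSpace 𝕜 G.Space.{u} := PBanachSpace.ofNormedSpace 𝕜 _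

/-- Evaluation of a functional of the family. -/
def eval (g : G.carrier) : G.Space.{u} →L[𝕜] 𝕜 :=
  LinearMap.mkContinuous
    { toFun := fun f => f.1 ⟨g⟩
      map_add' := fun _ _ => rfl
      map_smul' := fun _ _ => rfl } 1 fun f =>
    (lp.norm_apply_le_norm ENNReal.top_ne_zero f.1 ⟨g⟩).trans_eq (one_mul _).symm

theorem norm_eval_le (g : G.carrier) (f : G.Space.{u}) : ‖G.eval g f‖ ≤ ‖f‖ :=
  lp.norm_apply_le_norm ENNReal.top_ne_zero f.1 ⟨g⟩

/-- The unit vectors as elements of the space. -/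
def vec (n : ℕ) : G.Space.{u} :=
  ⟨G.unitVec n, Submodule.le_topologicalClosure _ (Submodule.subset_span ⟨n, rfl⟩)⟩

theorem eval_vec (g : G.carrier) (n : ℕ) : G.eval g (G.vec.{u} n) = g.1 n := rfl

theorem dense_span_vec : Dense (Submodule.span 𝕜 (Set.range G.vec.{u}) : Set G.Space.{u}) := by
  have h : (Subtype.val '' (Submodule.span 𝕜 (Set.range G.vec.{u}) : Set G.Space.{u})) =
      (Submodule.span 𝕜 (Set.range G.unitVec) : Set _) := by
    have h₁ := Submodule.map_span G.closedSpan.{u}.subtype (Set.range G.vec.{u})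
    have h₂ : G.closedSpan.{u}.subtype '' Set.range G.vec.{u} = Set.range G.unitVec.{u} :=
      (Set.range_comp _ _).symm
    rw [h₂] at h₁
    exact congrArg SetLike.coe h₁
  refine Subtype.dense_iff.2 fun x hx => ?_
  have hx' : x ∈ closure (Submodule.span 𝕜 (Set.range G.unitVec.{u}) : Set _) := hx
  rw [← h] at hx'
  exact hx'

/-- The unit vector system of the space given by a norming family. -/
def system : FundamentalMinimalSystem 𝕜 G.Space.{u} where
  vec := G.vec
  dual n := G.eval ⟨_, G.single_mem n⟩
  dense_span := G.dense_span_vec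
  biorthogonal i j := by
    rw [eval_vec]; simp [Finsupp.single_apply]
  bounded_vec := ⟨1, fun n => lp.norm_le_of_forall_le zero_le_one fun g =>
    G.norm_le_one _ g.down.2 n⟩
  bounded_dual := ⟨1, fun n f => by rw [one_mul]; exact G.norm_eval_le _ f⟩

theorem eval_eq_sum (g : G.carrier) (f : G.Space.{u}) :
    G.eval g f = g.1.sum fun n c => c * G.system.dual n f := by
  have h : G.eval g = ∑ n ∈ g.1.support, g.1 n • G.system.{u}.dual n := by
    refine ContinuousLinearMap.ext_on G.dense_span_vec ?_
    rintro _ ⟨j, rfl⟩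
    have := G.system.{u}.biorthogonal
    change g.1 j = _
    simp only [sum_apply, smul_apply]
    change _ = ∑ n ∈ g.1.support, g.1 n • G.system.{u}.dual n (G.system.vec j)
    simp only [this, smul_eq_mul, mul_ite, mul_one, mul_zero, Finset.sum_ite_eq',
      Finsupp.mem_support_iff, ne_eq, ite_not]
    split_ifs with h <;> simp [h]
  rw [h]
  simp [Finsupp.sum, sum_apply]

theorem norm_sum_le {g : ℕ →₀ 𝕜} (hg : g ∈ G.carrier) (f : G.Space.{u}) :
    ‖g.sum fun n c => c * G.system.dual n f‖ ≤ qnorm 𝕜 f := by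
  rw [← G.eval_eq_sum ⟨g, hg⟩]
  exact G.norm_eval_le _ f

theorem norm_dual_le (n : ℕ) (f : G.Space.{u}) : ‖G.system.dual n f‖ ≤ qnorm 𝕜 f :=
  G.norm_eval_le _ f

theorem qnorm_le {f : G.Space.{u}} {C : ℝ} (hC : 0 ≤ C)
    (h : ∀ g ∈ G.carrier, ‖g.sum fun n c => c * G.system.dual n f‖ ≤ C) : qnorm 𝕜 f ≤ C := by
  refine lp.norm_le_of_forall_le hC fun g => ?_
  have := h _ g.down.2
  rw [← G.eval_eq_sum g.down] at this
  exact this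

/-- A coordinate projection is contractive if the family is stable under the corresponding
truncation. -/
theorem qnorm_proj_le {F : Finset ℕ}
    (hF : ∀ g ∈ G.carrier, g.filter (· ∈ F) = 0 ∨ g.filter (· ∈ F) ∈ G.carrier)
    (f : G.Space.{u}) : qnorm 𝕜 (G.system.proj F f) ≤ qnorm 𝕜 f := by
  refine G.qnorm_le (qnorm_nonneg _) fun g hg => ?_
  have h : (g.sum fun n c => c * G.system.dual n (G.system.proj F f)) =
      (g.filter (· ∈ F)).sum fun n c => c * G.system.dual n f := by
    rw [Finsupp.sum, Finsupp.sum, Finsupp.support_filter, Finset.sum_filter]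
    refine Finset.sum_congr rfl fun n _ => ?_
    rw [FundamentalMinimalSystem.dual_proj]
    by_cases hn : n ∈ F <;> simp [hn]
  rw [h]
  rcases hF g hg with h₀ | h₁
  · rw [h₀]; simpa using qnorm_nonneg (𝕜 := 𝕜) f
  · exact G.norm_sum_le h₁ f

end NormingFamily

/-- A system is a Markushevich basis if the coordinate projections onto an exhausting sequence of
finite sets are contractive. -/
theorem FundamentalMinimalSystem.isMarkushevich_of_tendsto {𝕜 : Type} [RCLike 𝕜] {X : Type u}
    [AddCommGroup X] [Module 𝕜 X] [UniformSpace X] [IsUniformAddGroup X] [PBanachSpace 𝕜 X]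
    (S : FundamentalMinimalSystem 𝕜 X) (F : ℕ → Finset ℕ)
    (hF : Filter.Tendsto F Filter.atTop Filter.atTop)
    (hP : ∀ k f, qnorm 𝕜 (S.proj (F k) f) ≤ qnorm 𝕜 f) : S.IsMarkushevich := by
  obtain ⟨K, hK, hadd⟩ := exists_qnorm_add_le 𝕜 X
  have hmem : ∀ n, ∀ᶠ k in Filter.atTop, n ∈ F k := fun n => by
    filter_upwards [hF.eventually_ge_atTop {n}] with k hk
    simpa using hk
  have hspan : ∀ g ∈ Submodule.span 𝕜 (Set.range S.vec), ∀ᶠ k in Filter.atTop,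
      S.proj (F k) g = g := by
    intro g hg
    induction hg using Submodule.span_induction with
    | mem x hx =>
      obtain ⟨j, rfl⟩ := hx
      filter_upwards [hmem j] with k hk
      simp [proj, S.biorthogonal, hk]
    | zero => simp [proj]
    | add x y _ _ hx hy =>
      filter_upwards [hx, hy] with k h₁ h₂
      rw [proj] at h₁ h₂ ⊢
      simp [add_smul, Finset.sum_add_distrib, h₁, h₂]
    | smul a x _ hx =>
      filter_upwards [hx] with k h
      rw [proj] at h ⊢
      simp [mul_smul, ← Finset.smul_sum, h]
  have htend : ∀ f, Filter.Tendsto (fun k => S.proj (F k) f) Filter.atTop (𝓝 f) := by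
    intro f
    have h : Filter.Tendsto (fun k => S.proj (F k) f - f) Filter.atTop (𝓝 0) := by
      refine (nhds_zero_basis (𝕜 := 𝕜) (X := X)).tendsto_right_iff.2 fun r hr => ?_
      have hK₀ : 0 < 2 * K := by linarith
      obtain ⟨g, hg, hfg⟩ := exists_qnorm_sub_lt (𝕜 := 𝕜) S.dense_span f (div_pos hr hK₀)
      filter_upwards [hspan g hg] with k hk
      have hsub : S.proj (F k) f - f = S.proj (F k) (f - g) + -(f - g) := by
        have : S.proj (F k) (f - g) = S.proj (F k) f - S.proj (F k) g := by
          simp [proj, sub_smul, Finset.sum_sub_distrib]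
        rw [this, hk]; abel
      change qnorm 𝕜 _ < r
      rw [hsub]
      calc _ ≤ K * (qnorm 𝕜 (f - g) + qnorm 𝕜 (f - g)) := by
            refine (hadd _ _).trans ?_
            rw [qnorm_neg]
            gcongr
            exact hP k _
        _ = 2 * K * qnorm 𝕜 (f - g) := by ring
        _ < 2 * K * (r / (2 * K)) := by gcongr
        _ = r := by field_simp
    simpa using h.add_const f
  intro φ
  refine mem_closure_of_tendsto (b := Filter.atTop)
    (f := fun k => StrongDual.toWeakDual (∑ n ∈ F k, φ (S.vec n) • S.dual n)) ?_
    (Filter.Eventually.of_forall fun k => ?_)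
  · refine tendsto_iff_forall_eval_tendsto_topDualPairing.2 fun f => ?_
    have h : ∀ k, (∑ n ∈ F k, φ (S.vec n) • S.dual n) f = φ (S.proj (F k) f) := by
      intro k
      rw [proj, map_sum φ, sum_apply]
      refine Finset.sum_congr rfl fun n _ => ?_
      rw [map_smul φ, smul_apply, smul_eq_mul, smul_eq_mul, mul_comm]
    change Filter.Tendsto (fun k => (∑ n ∈ F k, φ (S.vec n) • S.dual n) f) _ (𝓝 (φ f))
    simp only [h]
    exact ((map_continuous φ).tendsto f).comp (htend f)
  · rw [map_sum]
    refine Submodule.sum_mem _ fun n _ => ?_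
    rw [map_smul]
    exact Submodule.smul_mem _ _ (Submodule.subset_span ⟨n, rfl⟩)

section

variable {𝕜 : Type} [RCLike 𝕜]

theorem Finsupp.sum_indicator_mul (D : Finset ℕ) (a x : ℕ → 𝕜) :
    ((Finsupp.indicator D fun i _ => a i).sum fun n c => c * x n) = ∑ n ∈ D, a n * x n := by
  rw [Finsupp.sum_of_support_subset _ (Finsupp.support_indicator_subset _ _) _ (by simp)]
  exact Finset.sum_congr rfl fun n hn => by simp [hn]

theorem Finsupp.filter_mem_indicator (D F : Finset ℕ) (a : ℕ → 𝕜) :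
    (Finsupp.indicator D fun i _ => a i).filter (· ∈ F) =
      Finsupp.indicator (D.filter (· ∈ F)) fun i _ => a i := by
  ext n
  by_cases hn : n ∈ F <;> by_cases hD : n ∈ D <;> simp [hn, hD]

theorem Finsupp.filter_mem_single (F : Finset ℕ) (n : ℕ) :
    (Finsupp.single n (1 : 𝕜)).filter (· ∈ F) = 0 ∨
      (Finsupp.single n (1 : 𝕜)).filter (· ∈ F) = Finsupp.single n 1 := by
  by_cases hn : n ∈ F
  · exact Or.inr (Finsupp.filter_single_of_pos _ hn)
  · exact Or.inl (Finsupp.filter_single_of_neg _ hn)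

/-- A combination of the coefficients of a signed sum sees only the intersection of the sets. -/
theorem norm_sum_mul_ite_le {a ε : ℕ → 𝕜} (D A : Finset ℕ) (ha : ∀ i, ‖a i‖ ≤ 1)
    (hε : IsSignOn ε A) :
    ‖∑ n ∈ D, a n * (if n ∈ A then ε n else 0)‖ ≤ ((D ∩ A).card : ℝ) := by
  have h : ∑ n ∈ D, a n * (if n ∈ A then ε n else 0) = ∑ n ∈ D ∩ A, a n * ε n := by
    simp [Finset.sum_ite_mem]
  rw [h]
  refine (norm_sum_le _ _).trans ((Finset.sum_le_card_nsmul _ _ 1 fun n hn => ?_).trans (by simp))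
  rw [norm_mul, hε n (Finset.mem_inter.1 hn).2, mul_one]
  exact ha n

end

namespace NormingFamily

variable {𝕜 : Type} [RCLike 𝕜] (G : NormingFamily 𝕜)

theorem qnorm_signedSum_le {ε : ℕ → 𝕜} {A : Finset ℕ} (hε : IsSignOn ε A) :
    qnorm 𝕜 (G.system.{u}.signedSum ε A) ≤ A.card := by
  refine G.qnorm_le (Nat.cast_nonneg _) fun g hg => ?_
  simp only [FundamentalMinimalSystem.dual_signedSum]
  refine (norm_sum_mul_ite_le g.support A (G.norm_le_one g hg) hε).trans ?_
  exact_mod_cast Finset.card_le_card Finset.inter_subset_right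

theorem disjointSqueezeSymmetry_le (m : ℕ) :
    disjointSqueezeSymmetry 𝕜 _ G.system.{u} m ≤ ENNReal.ofReal m := by
  refine G.system.disjointSqueezeSymmetry_le_of_forall (Nat.cast_nonneg _)
    fun f A B ε t ht₀ hne hB hc hm hε hd ht => ?_
  obtain ⟨b, hb⟩ := hne
  have h₁ : t ≤ qnorm 𝕜 f := (ht b hb).trans (G.norm_dual_le b f)
  have h₂ := G.qnorm_signedSum_le.{u} hε
  have h₃ : (A.card : ℝ) ≤ m := by exact_mod_cast hm
  calc _ ≤ qnorm 𝕜 f * m := mul_le_mul h₁ (h₂.trans h₃) (qnorm_nonneg _) (qnorm_nonneg _)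
    _ = _ := mul_comm _ _

end NormingFamily

/-- The norming family of the summing basis: coordinates and partial sums. -/
def summingFamily (𝕜 : Type) [RCLike 𝕜] : NormingFamily 𝕜 where
  carrier := Set.range (fun n => Finsupp.single n 1) ∪
    Set.range fun n => Finsupp.indicator (Finset.range n) fun _ _ => 1
  norm_le_one := by
    rintro _ (⟨k, rfl⟩ | ⟨k, rfl⟩) n
    · rw [Finsupp.single_apply]; split_ifs <;> simp
    · rw [Finsupp.indicator_apply]; split_ifs <;> simp
  single_mem n := Or.inl ⟨n, rfl⟩

namespace summingFamily

variable (𝕜 : Type) [RCLike 𝕜]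

theorem isSchauder : (summingFamily 𝕜).system.{u}.IsSchauder := by
  have h : ∀ (m : ℕ) (f : (summingFamily 𝕜).Space.{u}),
      qnorm 𝕜 ((summingFamily 𝕜).system.proj (Finset.range m) f) ≤ qnorm 𝕜 f := by
    intro m f
    refine (summingFamily 𝕜).qnorm_proj_le ?_ f
    rintro _ (⟨k, rfl⟩ | ⟨k, rfl⟩)
    · exact (Finsupp.filter_mem_single _ k).imp_right fun h => Or.inl ⟨k, h.symm⟩
    · refine Or.inr (Or.inr ⟨min k m, ?_⟩)
      have : (Finset.range k).filter (· ∈ Finset.range m) = Finset.range (min k m) := by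
        ext; simp
      change _ = (Finsupp.indicator (Finset.range k) fun _ _ => (1 : 𝕜)).filter _
      rw [Finsupp.filter_mem_indicator _ _ fun _ => (1 : 𝕜), this]
  exact ⟨FundamentalMinimalSystem.isMarkushevich_of_tendsto _ _ Filter.tendsto_finset_range h,
    1, fun m f => by simpa using h m f⟩

theorem disjointSqueezeSymmetry_eq (m : ℕ) :
    disjointSqueezeSymmetry 𝕜 _ (summingFamily 𝕜).system.{u} m = ENNReal.ofReal m := by
  refine le_antisymm ((summingFamily 𝕜).disjointSqueezeSymmetry_le m) ?_
  rcases m.eq_zero_or_pos with rfl | hm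
  · simp
  refine le_sInf fun C hC => ?_
  set S := (summingFamily 𝕜).system.{u}
  set f := S.signedSum (fun i => (-1 : 𝕜) ^ i) (Finset.range m) with hf
  have hne : (Finset.range m).Nonempty := ⟨0, Finset.mem_range.2 hm⟩
  have h := hC f (Finset.Ico m (m + m)) (Finset.range m) hne (fun _ => 1)
    (S.isGreedySet_signedSum _ _) (by simp) (by simp) (by simp [IsSignOn]) (by
      rw [Set.disjoint_left]
      intro n hn
      have : ¬ n < m := not_lt.2 (Finset.mem_Ico.1 (Finset.mem_coe.1 hn)).1
      simp [FundamentalMinimalSystem.supp, hf, FundamentalMinimalSystem.dual_signedSum, this])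
  have hinf : 1 ≤ (Finset.range m).inf' hne fun n => ‖S.dual n f‖ :=
    (Finset.le_inf'_iff _ _).2 fun n hn => by
      simp [hf, FundamentalMinimalSystem.dual_signedSum, Finset.mem_range.1 hn]
  have hA : (m : ℝ) ≤ qnorm 𝕜 (S.signedSum (fun _ => (1 : 𝕜)) (Finset.Ico m (m + m))) := by
    have := (summingFamily 𝕜).norm_sum_le (Or.inr ⟨m + m, rfl⟩)
      (S.signedSum (fun _ => (1 : 𝕜)) (Finset.Ico m (m + m)))
    rw [Finsupp.sum_indicator_mul _ fun _ => (1 : 𝕜)] at this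
    refine le_trans ?_ this
    change _ ≤ ‖∑ n ∈ Finset.range (m + m), 1 * S.dual n _‖
    simp only [FundamentalMinimalSystem.dual_signedSum, one_mul, Finset.sum_ite_mem]
    rw [Finset.inter_eq_right.2 fun n hn => Finset.mem_range.2 (Finset.mem_Ico.1 hn).2]
    simp
  have hB : qnorm 𝕜 f ≤ 1 := by
    refine (summingFamily 𝕜).qnorm_le zero_le_one ?_
    rintro _ (⟨k, rfl⟩ | ⟨k, rfl⟩)
    · change ‖(Finsupp.single k (1 : 𝕜)).sum fun n c => c * S.dual n f‖ ≤ 1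
      rw [Finsupp.sum_single_index (by simp), hf, FundamentalMinimalSystem.dual_signedSum]
      split_ifs <;> simp
    · change ‖(Finsupp.indicator (Finset.range k) fun _ _ => (1 : 𝕜)).sum
        fun n c => c * S.dual n f‖ ≤ 1
      rw [Finsupp.sum_indicator_mul _ fun _ => (1 : 𝕜), hf]
      simp only [FundamentalMinimalSystem.dual_signedSum, one_mul, Finset.sum_ite_mem]
      have : Finset.range k ∩ Finset.range m = Finset.range (min k m) := by ext; simp
      rw [this, neg_one_geom_sum]
      split_ifs <;> simp
  calc ENNReal.ofReal m ≤ ENNReal.ofReal (((Finset.range m).inf' hne fun n => ‖S.dual n f‖) *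
        qnorm 𝕜 (S.signedSum (fun _ => (1 : 𝕜)) (Finset.Ico m (m + m)))) :=
        ENNReal.ofReal_le_ofReal (hA.trans (le_mul_of_one_le_left (qnorm_nonneg _) hinf))
    _ ≤ C * ENNReal.ofReal (qnorm 𝕜 f) := h
    _ ≤ C * ENNReal.ofReal 1 := by gcongr
    _ = C := by simp

end summingFamily

theorem notMem_exponentsS_of_lt_one (𝕜 : Type) [RCLike 𝕜] {r : ℝ} (hr : r < 1) :
    r ∉ exponentsS (squeezeSymmetry.{u} 𝕜) (disjointSqueezeSymmetry.{u} 𝕜) := by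
  intro h
  obtain ⟨C, hC⟩ := h _ _ (summingFamily.isSchauder.{u} 𝕜)
  have hbound : ∀ m : ℕ, 1 ≤ m → (m : ℝ) ^ (1 - r) ≤ C := by
    intro m hm
    have hm₀ : (0 : ℝ) < m := by exact_mod_cast hm
    have h₁ := hC m hm
    have h₂ := (ENNReal.div_le_div_right
      ((summingFamily 𝕜).system.{u}.disjointSqueezeSymmetry_le_squeezeSymmetry m) _).trans h₁
    rw [summingFamily.disjointSqueezeSymmetry_eq, ENNReal.ofReal_rpow_of_pos hm₀,
      ← ENNReal.ofReal_div_of_pos (Real.rpow_pos_of_pos hm₀ _)] at h₂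
    rw [Real.rpow_sub hm₀, Real.rpow_one]
    have := ENNReal.toReal_mono ENNReal.coe_ne_top h₂
    rwa [ENNReal.toReal_ofReal (by positivity)] at this
  have ht := (tendsto_rpow_atTop (sub_pos.2 hr)).comp (tendsto_natCast_atTop_atTop (R := ℝ))
  obtain ⟨m, hm, hm'⟩ := ((Filter.eventually_ge_atTop 1).and
    (ht.eventually_gt_atTop (C : ℝ))).exists
  exact absurd (hbound m hm) (not_le.2 hm')

namespace RCLike

variable {𝕜 : Type} [RCLike 𝕜]

/-- A scalar of modulus at most one which rotates `z` to `‖z‖`. -/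
def counterPhase (z : 𝕜) : 𝕜 := starRingEnd 𝕜 z / (‖z‖ : 𝕜)

theorem norm_counterPhase_le (z : 𝕜) : ‖counterPhase z‖ ≤ 1 := by
  rw [counterPhase, norm_div, norm_conj, norm_ofReal, abs_norm]
  exact div_self_le_one _

theorem counterPhase_mul (z : 𝕜) : counterPhase z * z = (‖z‖ : 𝕜) := by
  rcases eq_or_ne z 0 with rfl | hz
  · simp
  have : (‖z‖ : 𝕜) ≠ 0 := by simpa using hz
  rw [counterPhase, div_mul_eq_mul_div, RCLike.conj_mul, sq, mul_div_assoc, div_self this, mul_one]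

end RCLike

/-- The weights of the block construction. -/
def blockWeight (j : ℕ) : ℕ := 2 ^ (j + 1).factorial

/-- The endpoints of the blocks. -/
def blockEnd (j : ℕ) : ℕ := blockWeight j ^ 2

/-- The `j`-th block. -/
def block (j : ℕ) : Finset ℕ := Finset.Ico (blockEnd j) (blockEnd (j + 1))

theorem two_le_blockWeight (j : ℕ) : 2 ≤ blockWeight j :=
  Nat.le_self_pow (Nat.factorial_ne_zero _) 2

theorem blockWeight_succ (j : ℕ) : blockWeight (j + 1) = blockWeight j ^ (j + 2) := by
  rw [blockWeight, blockWeight, ← pow_mul, Nat.factorial_succ, mul_comm]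

theorem blockEnd_le_blockWeight_succ (j : ℕ) : blockEnd j ≤ blockWeight (j + 1) := by
  rw [blockWeight_succ]
  exact Nat.pow_le_pow_right (by have := two_le_blockWeight j; omega) (by omega)

theorem blockWeight_le_blockEnd (j : ℕ) : blockWeight j ≤ blockEnd j :=
  Nat.le_self_pow two_ne_zero _

theorem blockWeight_mono : Monotone blockWeight :=
  monotone_nat_of_le_succ fun j => (blockWeight_le_blockEnd j).trans (blockEnd_le_blockWeight_succ j)

theorem blockEnd_mono : Monotone blockEnd := fun _ _ h => Nat.pow_le_pow_left (blockWeight_mono h) 2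

theorem blockEnd_le_blockWeight {i j : ℕ} (h : i < j) : blockEnd i ≤ blockWeight j :=
  (blockEnd_le_blockWeight_succ i).trans (blockWeight_mono h)

theorem two_mul_blockEnd_le (j : ℕ) : 2 * blockEnd j ≤ blockEnd (j + 1) := by
  have h₁ := blockEnd_le_blockWeight_succ j
  have h₂ := two_le_blockWeight (j + 1)
  calc 2 * blockEnd j ≤ blockWeight (j + 1) * blockWeight (j + 1) := Nat.mul_le_mul h₂ h₁
    _ = _ := (sq _).symm

theorem two_dvd_blockEnd (j : ℕ) : 2 ∣ blockEnd j :=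
  (dvd_pow_self 2 (Nat.factorial_ne_zero _)).trans (dvd_pow_self _ two_ne_zero)

theorem tendsto_blockWeight : Filter.Tendsto blockWeight Filter.atTop Filter.atTop :=
  Filter.tendsto_atTop_mono (fun j => ((Nat.self_le_factorial (j + 1)).trans
    (Nat.lt_two_pow_self).le).trans' (Nat.le_succ j)) Filter.tendsto_id

theorem disjoint_block {i j : ℕ} (h : i ≠ j) : Disjoint (block i) (block j) := by
  rw [Finset.disjoint_left]
  intro n hi hj
  rw [block, Finset.mem_Ico] at hi hj
  rcases h.lt_or_gt with h | h
  · have := blockEnd_mono (show i + 1 ≤ j from h); omega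
  · have := blockEnd_mono (show j + 1 ≤ i from h); omega

/-- The pairs of a finite set and coefficients which are tested with weight `blockWeight j`: either
the set is small and far out, or it is the `j`-th block and the coefficients have sum zero. -/
def IsBlockTest {𝕜 : Type} [RCLike 𝕜] (j : ℕ) (D : Finset ℕ) (a : ℕ → 𝕜) : Prop :=
  (∀ i, ‖a i‖ ≤ 1) ∧ ((D.card ≤ blockEnd j ∧ ∀ i ∈ D, blockEnd j ≤ i) ∨
    (D = block j ∧ ∑ i ∈ D, a i = 0))

/-- A norming family for which the constant functions on blocks are much smaller than their
restrictions to halves of the blocks. -/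
def blockFamily (𝕜 : Type) [RCLike 𝕜] : NormingFamily 𝕜 where
  carrier := Set.range (fun n => Finsupp.single n 1) ∪
    {g | ∃ (j : ℕ) (D : Finset ℕ) (a : ℕ → 𝕜), IsBlockTest j D a ∧
      g = Finsupp.indicator D fun i _ => (blockWeight j : 𝕜)⁻¹ * a i}
  norm_le_one := by
    rintro _ (⟨k, rfl⟩ | ⟨j, D, a, h, rfl⟩) n
    · rw [Finsupp.single_apply]; split_ifs <;> simp
    · rw [Finsupp.indicator_apply]
      split_ifs
      · rw [norm_mul, norm_inv, RCLike.norm_natCast]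
        have : (1 : ℝ) ≤ blockWeight j := by
          exact_mod_cast one_le_two.trans (two_le_blockWeight j)
        exact mul_le_one₀ (inv_le_one_of_one_le₀ this) (norm_nonneg _) (h.1 n)
      · simp
  single_mem n := Or.inl ⟨n, rfl⟩

namespace blockFamily

variable {𝕜 : Type} [RCLike 𝕜]

theorem blockWeight_pos (j : ℕ) : (0 : ℝ) < blockWeight j := by
  exact_mod_cast two_pos.trans_le (two_le_blockWeight j)

theorem sum_indicator_eq (j : ℕ) (D : Finset ℕ) (a x : ℕ → 𝕜) :
    ‖(Finsupp.indicator D fun i _ => (blockWeight j : 𝕜)⁻¹ * a i).sum fun n c => c * x n‖ =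
      ‖∑ n ∈ D, a n * x n‖ / blockWeight j := by
  rw [Finsupp.sum_indicator_mul D (fun i => (blockWeight j : 𝕜)⁻¹ * a i)]
  simp only [mul_assoc]
  rw [← Finset.mul_sum, norm_mul, norm_inv, RCLike.norm_natCast, inv_mul_eq_div]

theorem norm_sum_le {j : ℕ} {D : Finset ℕ} {a : ℕ → 𝕜} (h : IsBlockTest j D a)
    (f : (blockFamily 𝕜).Space.{u}) :
    ‖∑ n ∈ D, a n * (blockFamily 𝕜).system.dual n f‖ ≤ blockWeight j * qnorm 𝕜 f := by
  have := (blockFamily 𝕜).norm_sum_le (Or.inr ⟨j, D, a, h, rfl⟩) f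
  rw [sum_indicator_eq j D a fun n => (blockFamily 𝕜).system.dual n f,
    div_le_iff₀ (blockWeight_pos j)] at this
  rwa [mul_comm]

theorem qnorm_le {f : (blockFamily 𝕜).Space.{u}} {C : ℝ}
    (h₁ : ∀ n, ‖(blockFamily 𝕜).system.dual n f‖ ≤ C)
    (h₂ : ∀ j D (a : ℕ → 𝕜), IsBlockTest j D a →
      ‖∑ n ∈ D, a n * (blockFamily 𝕜).system.dual n f‖ ≤ blockWeight j * C) : qnorm 𝕜 f ≤ C := by
  refine (blockFamily 𝕜).qnorm_le ((norm_nonneg _).trans (h₁ 0)) ?_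
  rintro _ (⟨k, rfl⟩ | ⟨j, D, a, h, rfl⟩)
  · simpa [Finsupp.sum_single_index] using h₁ k
  · rw [sum_indicator_eq j D a fun n => (blockFamily 𝕜).system.dual n f,
      div_le_iff₀ (blockWeight_pos j), mul_comm]
    exact h₂ j D a h

theorem card_mul_le_of_far {j : ℕ} {D : Finset ℕ} (hc : D.card ≤ blockEnd j)
    (hD : ∀ i ∈ D, blockEnd j ≤ i) {f : (blockFamily 𝕜).Space.{u}} {t : ℝ}
    (ht : ∀ n ∈ D, t ≤ ‖(blockFamily 𝕜).system.dual n f‖) :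
    t * D.card ≤ blockWeight j * qnorm 𝕜 f := by
  have := norm_sum_le (a := fun n => RCLike.counterPhase ((blockFamily 𝕜).system.dual n f))
    ⟨fun i => RCLike.norm_counterPhase_le _, Or.inl ⟨hc, hD⟩⟩ f
  simp only [RCLike.counterPhase_mul] at this
  rw [← RCLike.ofReal_sum, RCLike.norm_ofReal,
    abs_of_nonneg (Finset.sum_nonneg fun _ _ => norm_nonneg _)] at this
  refine le_trans ?_ this
  have := D.card_nsmul_le_sum _ t ht
  rwa [nsmul_eq_mul, mul_comm] at this

/-- Coefficients inside a block are controlled as long as there is room to compensate them. -/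
theorem card_mul_le_of_block {j : ℕ} {D A : Finset ℕ} (hD : D ⊆ block j) (hA : A ⊆ block j)
    (hDA : Disjoint D A) (hc : D.card ≤ A.card) {f : (blockFamily 𝕜).Space.{u}} {t : ℝ}
    (hf : ∀ n ∈ A, (blockFamily 𝕜).system.dual n f = 0)
    (ht : ∀ n ∈ D, t ≤ ‖(blockFamily 𝕜).system.dual n f‖) :
    t * D.card ≤ blockWeight j * qnorm 𝕜 f := by
  rcases A.eq_empty_or_nonempty with rfl | hne
  · have : D.card = 0 := by simpa using hc
    rw [this]
    simpa using mul_nonneg (blockWeight_pos j).le (qnorm_nonneg (𝕜 := 𝕜) f)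
  have hA₀ : (0 : ℝ) < A.card := by exact_mod_cast Finset.card_pos.2 hne
  have hA₁ : (A.card : 𝕜) ≠ 0 := by exact_mod_cast (Finset.card_pos.2 hne).ne'
  set σ : ℕ → 𝕜 := fun n => RCLike.counterPhase ((blockFamily 𝕜).system.dual n f)
  set s : 𝕜 := ∑ n ∈ D, σ n with hs
  have hsn : ‖s‖ ≤ A.card := by
    refine (norm_sum_le_of_le D (f := σ) (n := fun _ => 1)
      fun n _ => RCLike.norm_counterPhase_le _).trans ?_
    simpa using hc
  set a : ℕ → 𝕜 := fun n => if n ∈ D then σ n else if n ∈ A then -s / A.card else 0 with ha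
  have haD : ∀ n ∈ D, a n = σ n := fun n hn => by simp [ha, hn]
  have haA : ∀ n ∈ A, a n = -s / A.card := fun n hn => by
    simp [ha, hn, Finset.disjoint_right.1 hDA hn]
  have hsub : D ∪ A ⊆ block j := Finset.union_subset hD hA
  have hout : ∀ n ∈ block j, n ∉ D ∪ A → a n = 0 := fun n _ hn => by
    rw [Finset.mem_union, not_or] at hn
    simp [ha, hn.1, hn.2]
  have htest : IsBlockTest j (block j) a := by
    refine ⟨fun n => ?_, Or.inr ⟨rfl, ?_⟩⟩
    · simp only [ha]
      split_ifs
      · exact RCLike.norm_counterPhase_le _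
      · rw [norm_div, norm_neg, RCLike.norm_natCast]
        exact div_le_one_of_le₀ hsn hA₀.le
      · simp
    · rw [← Finset.sum_subset hsub hout, Finset.sum_union hDA, Finset.sum_congr rfl haD,
        Finset.sum_congr rfl haA, Finset.sum_const, nsmul_eq_mul, mul_div_cancel₀ _ hA₁, ← hs,
        add_neg_cancel]
  have := norm_sum_le htest f
  rw [← Finset.sum_subset hsub fun n h₁ h₂ => by rw [hout n h₁ h₂, zero_mul],
    Finset.sum_union hDA, Finset.sum_eq_zero (s := A) fun n hn => by rw [hf n hn, mul_zero],
    add_zero, Finset.sum_congr rfl fun n hn => by rw [haD n hn, RCLike.counterPhase_mul],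
    ← RCLike.ofReal_sum, RCLike.norm_ofReal,
    abs_of_nonneg (Finset.sum_nonneg fun _ _ => norm_nonneg _)] at this
  refine le_trans ?_ this
  have := D.card_nsmul_le_sum _ t ht
  rwa [nsmul_eq_mul, mul_comm] at this

theorem card_le_mul_of_isBlockTest {i j : ℕ} {D A : Finset ℕ} {a : ℕ → 𝕜}
    (h : IsBlockTest i D a) (hA : A.card ≤ blockEnd (j + 1)) (hij : D = block i → i ≠ j) :
    (D ∩ A).card ≤ blockWeight i * blockWeight (j + 1) := by
  have h₁ : (D ∩ A).card ≤ A.card := Finset.card_le_card Finset.inter_subset_right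
  have h₂ : (D ∩ A).card ≤ D.card := Finset.card_le_card Finset.inter_subset_left
  have hA' : A.card ≤ blockWeight (j + 1) * blockWeight (j + 1) := by rwa [← sq]
  rcases le_or_gt (j + 1) i with hi | hi
  · exact (h₁.trans hA').trans (Nat.mul_le_mul_right _ (blockWeight_mono hi))
  rcases h.2 with ⟨hc, -⟩ | ⟨hD, -⟩
  · refine (h₂.trans hc).trans ?_
    rw [blockEnd, sq]
    exact Nat.mul_le_mul_left _ (blockWeight_mono hi.le)
  · have hlt : i + 1 < j + 1 := by have := hij hD; omega
    have hD' : D.card ≤ blockEnd (i + 1) := by rw [hD, block, Nat.card_Ico]; omega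
    have := (h₂.trans hD').trans (blockEnd_le_blockWeight hlt)
    have h2 := two_le_blockWeight i
    nlinarith

theorem disjointSqueezeSymmetry_le (j : ℕ) :
    disjointSqueezeSymmetry 𝕜 _ (blockFamily 𝕜).system.{u} (blockEnd (j + 1)) ≤
      ENNReal.ofReal (3 * blockWeight (j + 1)) := by
  have hw := blockWeight_pos (j + 1)
  have hw₁ : (1 : ℝ) ≤ blockWeight (j + 1) := by
    exact_mod_cast one_le_two.trans (two_le_blockWeight (j + 1))
  have hwj : (1 : ℝ) ≤ blockWeight j := by
    exact_mod_cast one_le_two.trans (two_le_blockWeight j)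
  refine (blockFamily 𝕜).system.disjointSqueezeSymmetry_le_of_forall (by positivity)
    fun f A B ε t ht₀ hne hB hc hm hε hd ht => ?_
  have hq := qnorm_nonneg (𝕜 := 𝕜) f
  rcases ht₀.eq_or_lt with rfl | ht₀
  · rw [zero_mul]; positivity
  obtain ⟨b, hb⟩ := hne
  have htq : t ≤ qnorm 𝕜 f := (ht b hb).trans ((blockFamily 𝕜).norm_dual_le b f)
  have hAf : ∀ n ∈ A, (blockFamily 𝕜).system.dual n f = 0 := fun n hn => by
    by_contra h
    exact Set.disjoint_left.1 hd (Finset.mem_coe.2 hn) h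
  have hAB : Disjoint B A := Finset.disjoint_left.2 fun n hn hn' => by
    have := ht n hn
    rw [hAf n hn', norm_zero] at this
    linarith
  rw [← le_div_iff₀' ht₀]
  set c := 3 * (blockWeight (j + 1) : ℝ) * qnorm 𝕜 f / t with hcdef
  have hc₁ : (blockWeight (j + 1) : ℝ) ≤ c := by
    rw [hcdef, le_div_iff₀ ht₀]
    nlinarith [mul_le_mul_of_nonneg_left htq hw.le, mul_nonneg hw.le hq]
  refine qnorm_le (fun n => ?_) fun i D a ha => ?_
  · rw [FundamentalMinimalSystem.dual_signedSum]
    split_ifs with h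
    · rw [hε n h]; linarith
    · rw [norm_zero]; linarith
  simp only [FundamentalMinimalSystem.dual_signedSum]
  refine (norm_sum_mul_ite_le D A ha.1 hε).trans ?_
  by_cases hij : D = block i → i ≠ j
  · have : ((D ∩ A).card : ℝ) ≤ blockWeight i * blockWeight (j + 1) := by
      exact_mod_cast card_le_mul_of_isBlockTest ha hm hij
    exact this.trans (mul_le_mul_of_nonneg_left hc₁ (blockWeight_pos i).le)
  push Not at hij
  obtain ⟨rfl, rfl⟩ := hij
  obtain ⟨D, hD, hDcard⟩ := Finset.exists_subset_card_eq
    (Nat.min_le_left (B ∩ block i).card (block i ∩ A).card)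
  have hD₁ : t * D.card ≤ blockWeight i * qnorm 𝕜 f :=
    card_mul_le_of_block (A := block i ∩ A) (hD.trans Finset.inter_subset_right)
      Finset.inter_subset_left
      (hAB.mono (hD.trans Finset.inter_subset_left) Finset.inter_subset_right)
      (by omega) (fun n hn => hAf n (Finset.mem_inter.1 hn).2)
      (fun n hn => ht n (Finset.mem_inter.1 (hD hn)).1)
  set B₁ := B.filter (· < blockEnd i)
  set B₃ := B.filter (blockEnd (i + 1) ≤ ·)
  have hB₁ : (B₁.card : ℝ) ≤ blockWeight (i + 1) := by
    have h : B₁ ⊆ Finset.range (blockEnd i) := fun n hn =>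
      Finset.mem_range.2 (Finset.mem_filter.1 hn).2
    have := Finset.card_le_card h
    rw [Finset.card_range] at this
    exact_mod_cast this.trans (blockEnd_le_blockWeight_succ i)
  have hB₃ : t * B₃.card ≤ blockWeight (i + 1) * qnorm 𝕜 f :=
    card_mul_le_of_far ((Finset.card_filter_le _ _).trans (hc.trans_le hm))
      (fun n hn => (Finset.mem_filter.1 hn).2) fun n hn => ht n (Finset.mem_filter.1 hn).1
  have hcard : (block i ∩ A).card ≤ B₁.card + D.card + B₃.card := by
    have h₁ : (block i ∩ A).card ≤ A.card := Finset.card_le_card Finset.inter_subset_right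
    have h₂ : B.card ≤ B₁.card + (B ∩ block i).card + B₃.card := by
      have : B ⊆ B₁ ∪ (B ∩ block i) ∪ B₃ := fun n hn => by
        simp only [B₁, B₃, block, Finset.mem_union, Finset.mem_inter, Finset.mem_filter,
          Finset.mem_Ico, hn, true_and]
        omega
      exact (Finset.card_le_card this).trans ((Finset.card_union_le _ _).trans
        (Nat.add_le_add_right (Finset.card_union_le _ _) _))
    omega
  have hcard' : ((block i ∩ A).card : ℝ) ≤ B₁.card + D.card + B₃.card := by exact_mod_cast hcard
  rw [hcdef, mul_div_assoc', le_div_iff₀ ht₀]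
  have hP : 0 ≤ (blockWeight (i + 1) : ℝ) * qnorm 𝕜 f := by positivity
  calc ((block i ∩ A).card : ℝ) * t ≤ (B₁.card + D.card + B₃.card) * t := by gcongr
    _ = B₁.card * t + t * D.card + t * B₃.card := by ring
    _ ≤ blockWeight (i + 1) * qnorm 𝕜 f + blockWeight i * qnorm 𝕜 f +
        blockWeight (i + 1) * qnorm 𝕜 f := by gcongr
    _ ≤ blockWeight (i + 1) * qnorm 𝕜 f + blockWeight (i + 1) * qnorm 𝕜 f +
        blockWeight (i + 1) * qnorm 𝕜 f := by
        gcongr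
        exact_mod_cast blockWeight_mono (Nat.le_succ i)
    _ = 1 * (3 * (blockWeight (i + 1) * qnorm 𝕜 f)) := by ring
    _ ≤ blockWeight i * (3 * (blockWeight (i + 1) * qnorm 𝕜 f)) := by gcongr
    _ = _ := by ring

theorem isMarkushevich : (blockFamily 𝕜).system.{u}.IsMarkushevich := by
  refine FundamentalMinimalSystem.isMarkushevich_of_tendsto _
    (fun k => Finset.range (blockEnd k)) ?_ fun k f => ?_
  · refine Filter.tendsto_finset_range.comp ?_
    exact Filter.tendsto_atTop_mono blockWeight_le_blockEnd tendsto_blockWeight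
  refine (blockFamily 𝕜).qnorm_proj_le ?_ f
  rintro _ (⟨n, rfl⟩ | ⟨j, D, a, h, rfl⟩)
  · exact (Finsupp.filter_mem_single _ n).imp_right fun h => Or.inl ⟨n, h.symm⟩
  rw [Finsupp.filter_mem_indicator D _ fun i => (blockWeight j : 𝕜)⁻¹ * a i]
  rcases h.2 with ⟨hc, hD⟩ | ⟨rfl, hs⟩
  · refine Or.inr (Or.inr ⟨j, _, a, ⟨h.1, Or.inl ⟨(Finset.card_filter_le _ _).trans hc,
      fun i hi => hD i (Finset.mem_filter.1 hi).1⟩⟩, rfl⟩)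
  rcases lt_or_ge j k with hjk | hjk
  · rw [Finset.filter_true_of_mem fun n hn => ?_]
    · exact Or.inr (Or.inr ⟨j, _, a, h, rfl⟩)
    · exact Finset.mem_range.2 ((Finset.mem_Ico.1 hn).2.trans_le (blockEnd_mono hjk))
  · rw [Finset.filter_false_of_mem fun n hn => ?_]
    · left; ext; simp
    · have := (Finset.mem_Ico.1 hn).1
      have := blockEnd_mono hjk
      rw [Finset.mem_range]; omega

theorem qnorm_indicatorSum_block_le (j : ℕ) :
    qnorm 𝕜 ((blockFamily 𝕜).system.{u}.indicatorSum (block j)) ≤ blockWeight j := by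
  have hsum : (blockFamily 𝕜).system.{u}.indicatorSum (block j) =
      (blockFamily 𝕜).system.signedSum (fun _ => 1) (block j) := by
    simp [FundamentalMinimalSystem.indicatorSum, FundamentalMinimalSystem.signedSum]
  have hwj : (1 : ℝ) ≤ blockWeight j := by
    exact_mod_cast one_le_two.trans (two_le_blockWeight j)
  rw [hsum]
  refine qnorm_le (fun n => ?_) fun i D a ha => ?_
  · rw [FundamentalMinimalSystem.dual_signedSum]
    split_ifs
    · simpa using hwj
    · simp
  simp only [FundamentalMinimalSystem.dual_signedSum]
  have hpos : (0 : ℝ) ≤ blockWeight i * blockWeight j := by positivity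
  have hzero : Disjoint D (block j) → ‖∑ n ∈ D, a n * (if n ∈ block j then (1 : 𝕜) else 0)‖ ≤
      blockWeight i * blockWeight j := fun h => by
    rw [Finset.sum_eq_zero fun n hn => by rw [if_neg (Finset.disjoint_left.1 h hn), mul_zero]]
    simpa using hpos
  rcases ha.2 with ⟨hc, hD⟩ | ⟨rfl, hs⟩
  · rcases le_or_gt i j with hij | hij
    · refine (norm_sum_mul_ite_le D (block j) ha.1 (by simp [IsSignOn])).trans ?_
      have h₁ : (D ∩ block j).card ≤ D.card := Finset.card_le_card Finset.inter_subset_left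
      have h₂ : blockEnd i ≤ blockWeight i * blockWeight j := by
        rw [blockEnd, sq]
        exact Nat.mul_le_mul_left _ (blockWeight_mono hij)
      exact_mod_cast (h₁.trans hc).trans h₂
    · refine hzero (Finset.disjoint_left.2 fun n hn hn' => ?_)
      have := hD n hn
      have := (Finset.mem_Ico.1 hn').2
      have := blockEnd_mono (show j + 1 ≤ i from hij)
      omega
  · rcases eq_or_ne i j with rfl | hij
    · have : ∑ n ∈ block i, a n * (if n ∈ block i then (1 : 𝕜) else 0) = ∑ n ∈ block i, a n :=
        Finset.sum_congr rfl fun n hn => by rw [if_pos hn, mul_one]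
      rw [this, hs]
      simpa using hpos
    · exact hzero (disjoint_block hij)

theorem le_qnorm_indicatorSum (j h : ℕ) (hh : blockEnd j + 2 * h = blockEnd (j + 1)) :
    (h : ℝ) ≤ blockWeight j * qnorm 𝕜 ((blockFamily 𝕜).system.{u}.indicatorSum
      (Finset.Ico (blockEnd j + h) (blockEnd j + h + 2 * h))) := by
  have hsum : (blockFamily 𝕜).system.{u}.indicatorSum
      (Finset.Ico (blockEnd j + h) (blockEnd j + h + 2 * h)) =
      (blockFamily 𝕜).system.signedSum (fun _ => 1)
        (Finset.Ico (blockEnd j + h) (blockEnd j + h + 2 * h)) := by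
    simp [FundamentalMinimalSystem.indicatorSum, FundamentalMinimalSystem.signedSum]
  rw [hsum]
  set a : ℕ → 𝕜 := fun n => if n < blockEnd j + h then -1 else 1 with ha
  have hsplit : ∀ x : ℕ → 𝕜, ∑ n ∈ block j, x n =
      ∑ n ∈ Finset.Ico (blockEnd j) (blockEnd j + h), x n +
        ∑ n ∈ Finset.Ico (blockEnd j + h) (blockEnd (j + 1)), x n := fun x =>
    (Finset.sum_Ico_consecutive _ (by omega) (by omega)).symm
  have ha₁ : ∀ n ∈ Finset.Ico (blockEnd j) (blockEnd j + h), a n = -1 := fun n hn => by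
    simp [ha, (Finset.mem_Ico.1 hn).2]
  have ha₂ : ∀ n ∈ Finset.Ico (blockEnd j + h) (blockEnd (j + 1)), a n = 1 := fun n hn => by
    simp [ha, (Finset.mem_Ico.1 hn).1]
  have hcard : blockEnd (j + 1) - (blockEnd j + h) = h := by omega
  have htest : IsBlockTest j (block j) a := by
    refine ⟨fun n => ?_, Or.inr ⟨rfl, ?_⟩⟩
    · simp only [ha]; split_ifs <;> simp
    · rw [hsplit, Finset.sum_congr rfl ha₁, Finset.sum_congr rfl ha₂]
      simp [hcard]
  have := norm_sum_le htest ((blockFamily 𝕜).system.{u}.signedSum (fun _ => 1)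
    (Finset.Ico (blockEnd j + h) (blockEnd j + h + 2 * h)))
  refine le_trans (le_of_eq ?_) this
  simp only [FundamentalMinimalSystem.dual_signedSum]
  rw [hsplit, Finset.sum_eq_zero (s := Finset.Ico (blockEnd j) (blockEnd j + h)) fun n hn => ?_,
    zero_add, Finset.sum_congr rfl (g := fun _ => (1 : 𝕜)) fun n hn => ?_]
  · simp [hcard]
  · rw [ha₂ n hn, if_pos, mul_one]
    rw [Finset.mem_Ico] at hn ⊢
    omega
  · rw [if_neg, mul_zero]
    rw [Finset.mem_Ico] at hn ⊢
    omega

theorem le_democracy (j : ℕ) :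
    ENNReal.ofReal ((blockWeight (j + 1) : ℝ) ^ 2 / (4 * (blockWeight j : ℝ) ^ 2)) ≤
      democracy 𝕜 _ (blockFamily 𝕜).system.{u} (blockEnd (j + 1)) := by
  obtain ⟨h, hh⟩ : ∃ h, blockEnd j + 2 * h = blockEnd (j + 1) := by
    obtain ⟨x, hx⟩ := two_dvd_blockEnd j
    obtain ⟨y, hy⟩ := two_dvd_blockEnd (j + 1)
    have := two_mul_blockEnd_le j
    exact ⟨y - x, by omega⟩
  have h4 : blockEnd (j + 1) ≤ 4 * h := by
    have := two_mul_blockEnd_le j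
    omega
  have h4' : (blockWeight (j + 1) : ℝ) ^ 2 ≤ 4 * h := by exact_mod_cast h4
  refine le_iSup_of_le (Finset.Ico (blockEnd j + h) (blockEnd j + h + 2 * h)) <|
    le_iSup_of_le (block j) <| le_iSup_of_le ?_ <| le_iSup_of_le ?_ <|
    ENNReal.ofReal_le_ofReal ?_
  · rw [block, Nat.card_Ico, Nat.card_Ico]; omega
  · rw [block, Nat.card_Ico]; omega
  set A := (blockFamily 𝕜).system.{u}.indicatorSum
    (Finset.Ico (blockEnd j + h) (blockEnd j + h + 2 * h))
  set B := (blockFamily 𝕜).system.{u}.indicatorSum (block j)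
  have hA : (h : ℝ) ≤ blockWeight j * qnorm 𝕜 A := le_qnorm_indicatorSum j h hh
  have hB : qnorm 𝕜 B ≤ blockWeight j := qnorm_indicatorSum_block_le j
  have hw := blockWeight_pos j
  have hB₀ : 0 < qnorm 𝕜 B := by
    refine qnorm_pos fun h₀ => ?_
    have h₁ : (blockFamily 𝕜).system.dual (blockEnd j) B = 1 := by
      have := (blockFamily 𝕜).system.{u}.dual_sum (fun _ => 1) (block j) (blockEnd j)
      simp only [one_smul] at this
      refine this.trans (if_pos ?_)
      have := two_mul_blockEnd_le j
      have := two_le_blockWeight j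
      have := blockWeight_le_blockEnd j
      rw [block, Finset.mem_Ico]; omega
    simp [h₀] at h₁
  rw [div_le_div_iff₀ (by positivity) hB₀]
  have hA₀ := qnorm_nonneg (𝕜 := 𝕜) A
  calc _ ≤ (4 * (blockWeight j * qnorm 𝕜 A)) * blockWeight j := by
        gcongr
        linarith
    _ = _ := by ring

end blockFamily

theorem notMem_exponentsM_of_lt_two (𝕜 : Type) [RCLike 𝕜] {r : ℝ} (hr : r < 2) :
    r ∉ exponentsM (democracy.{u} 𝕜) (disjointSqueezeSymmetry.{u} 𝕜) := by
  intro h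
  obtain ⟨C, hC⟩ := h _ _ (blockFamily.isMarkushevich.{u} (𝕜 := 𝕜))
  set s := max r 0 with hs
  have hs₂ : s < 2 := max_lt hr two_pos
  have hs₀ : 0 ≤ s := le_max_right _ _
  have hbound : ∀ j, (blockWeight (j + 1) : ℝ) ^ (2 - s) ≤
      C * 3 ^ s * 4 * (blockWeight j : ℝ) ^ 2 := by
    intro j
    have hw := blockFamily.blockWeight_pos j
    have hw' := blockFamily.blockWeight_pos (j + 1)
    have hm : 1 ≤ blockEnd (j + 1) := Nat.one_le_pow _ _ (by have := two_le_blockWeight (j+1); omega)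
    set x := disjointSqueezeSymmetry 𝕜 _ (blockFamily 𝕜).system.{u} (blockEnd (j + 1)) with hx
    have hx₁ : 1 ≤ x := (blockFamily 𝕜).system.one_le_disjointSqueezeSymmetry hm
    have hpow : x ^ r ≤ ENNReal.ofReal ((3 * blockWeight (j + 1)) ^ s) := by
      rw [← ENNReal.ofReal_rpow_of_nonneg (by positivity) hs₀]
      exact (ENNReal.rpow_le_rpow_of_exponent_le hx₁ (le_max_left r 0)).trans
        (ENNReal.rpow_le_rpow (blockFamily.disjointSqueezeSymmetry_le j) hs₀)
    have h₂ := (ENNReal.div_le_div (blockFamily.le_democracy j) hpow).trans (hC _ hm)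
    rw [← ENNReal.ofReal_div_of_pos (by positivity)] at h₂
    have h₃ := ENNReal.toReal_mono ENNReal.coe_ne_top h₂
    rw [ENNReal.toReal_ofReal (by positivity), ENNReal.coe_toReal, div_le_iff₀ (by positivity),
      div_le_iff₀ (by positivity), Real.mul_rpow (by positivity) hw'.le] at h₃
    rw [Real.rpow_sub hw', Real.rpow_two, div_le_iff₀ (by positivity)]
    linarith
  have hlim : ∀ᶠ j in Filter.atTop, (blockWeight j : ℝ) ≤ C * 3 ^ s * 4 := by
    have ht := (tendsto_natCast_atTop_atTop (R := ℝ)).atTop_mul_const (sub_pos.2 hs₂)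
    filter_upwards [ht.eventually_ge_atTop 3] with j hj
    have hw := blockFamily.blockWeight_pos j
    have hw₁ : (1 : ℝ) ≤ blockWeight j := by
      exact_mod_cast one_le_two.trans (two_le_blockWeight j)
    have h₁ := hbound j
    have h₂ : (blockWeight j : ℝ) ^ 3 ≤ (blockWeight (j + 1) : ℝ) ^ (2 - s) := by
      rw [blockWeight_succ, Nat.cast_pow, ← Real.rpow_natCast (blockWeight j : ℝ) (j + 2),
        ← Real.rpow_natCast (blockWeight j : ℝ) 3, ← Real.rpow_mul hw.le]
      refine Real.rpow_le_rpow_of_exponent_le hw₁ ?_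
      push_cast
      nlinarith
    have h₃ := h₂.trans h₁
    have h₄ : (blockWeight j : ℝ) ^ 3 = blockWeight j * (blockWeight j : ℝ) ^ 2 := by ring
    rw [h₄] at h₃
    exact le_of_mul_le_mul_right h₃ (by positivity)
  have htend := (tendsto_natCast_atTop_atTop (R := ℝ)).comp tendsto_blockWeight
  obtain ⟨j, h₁, h₂⟩ := (hlim.and (htend.eventually_gt_atTop (C * 3 ^ s * 4))).exists
  exact absurd h₁ (not_le.2 h₂)

section

variable {𝕜 : Type} [RCLike 𝕜]

theorem exponentsB_subset_exponentsM (a b : BasisParameter.{u} 𝕜) :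
    exponentsB a b ⊆ exponentsM a b := fun _ hR X _ _ _ _ _ S _ => hR X S

theorem exponentsM_subset_of_le {a a' b : BasisParameter.{u} 𝕜}
    (h : ∀ (X : Type u) [AddCommGroup X] [Module 𝕜 X] [UniformSpace X] [IsUniformAddGroup X]
      [PBanachSpace 𝕜 X] (S : FundamentalMinimalSystem 𝕜 X) (m : ℕ), a X S m ≤ a' X S m) :
    exponentsM a' b ⊆ exponentsM a b := fun _ hR X _ _ _ _ _ S hS => by
  obtain ⟨C, hC⟩ := hR X S hS
  exact ⟨C, fun m hm => (ENNReal.div_le_div_right (h X S m) _).trans (hC m hm)⟩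

theorem sInf_image_coe_eq {s : Set ℝ} {x : ℝ} (hx : x ∈ s) (h : ∀ r < x, r ∉ s) :
    sInf ((fun R : ℝ => (R : EReal)) '' s) = x := by
  refine IsLeast.csInf_eq ⟨⟨x, hx, rfl⟩, ?_⟩
  rintro _ ⟨r, hr, rfl⟩
  exact EReal.coe_le_coe_iff.2 (not_lt.1 fun hlt => h r hlt hr)

theorem IsOptimalPower.ratioB_eq {a b : BasisParameter.{u} 𝕜} {s : ℝ} (h : IsOptimalPower a b s) :
    ratioB a b = s :=
  sInf_image_coe_eq h.1 fun r hr hmem => h.2 r hr (exponentsB_subset_exponentsM a b hmem)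

theorem IsOptimalPower.ratioM_eq {a b : BasisParameter.{u} 𝕜} {s : ℝ} (h : IsOptimalPower a b s) :
    ratioM a b = s :=
  sInf_image_coe_eq (exponentsB_subset_exponentsM a b h.1) h.2

/-- A parameter which dominates the democracy parameter and is dominated by a multiple of the
squeeze symmetry parameter is optimally estimated by the square of the disjoint squeeze symmetry
parameter. -/
theorem isOptimalPower_two {a : BasisParameter.{u} 𝕜}
    (h₁ : ∀ (X : Type u) [AddCommGroup X] [Module 𝕜 X] [UniformSpace X] [IsUniformAddGroup X]
      [PBanachSpace 𝕜 X] (S : FundamentalMinimalSystem 𝕜 X) (m : ℕ),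
      democracy 𝕜 X S m ≤ a X S m)
    (h₂ : ∀ (X : Type u) [AddCommGroup X] [Module 𝕜 X] [UniformSpace X] [IsUniformAddGroup X]
      [PBanachSpace 𝕜 X] (S : FundamentalMinimalSystem 𝕜 X),
      ∃ C : ℝ≥0, ∀ m, 1 ≤ m → a X S m ≤ C * squeezeSymmetry 𝕜 X S m) :
    IsOptimalPower a (disjointSqueezeSymmetry.{u} 𝕜) 2 := by
  refine ⟨fun X _ _ _ _ _ S => ?_, fun r hr h =>
    notMem_exponentsM_of_lt_two 𝕜 hr (exponentsM_subset_of_le h₁ h)⟩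
  obtain ⟨C, hC⟩ := h₂ X S
  obtain ⟨C', -, hC'⟩ := S.exists_squeezeSymmetry_le_sq
  refine ⟨C * C', fun m hm => ENNReal.div_le_of_le_mul ((hC m hm).trans ?_)⟩
  rw [ENNReal.coe_mul, mul_assoc]
  gcongr
  exact hC' m hm

theorem one_mem_exponentsS :
    1 ∈ exponentsS (squeezeSymmetry.{u} 𝕜) (disjointSqueezeSymmetry.{u} 𝕜) := by
  intro X _ _ _ _ _ S hS
  obtain ⟨C, -, hC⟩ := hS.exists_squeezeSymmetry_le
  refine ⟨C, fun m hm => ENNReal.div_le_of_le_mul ?_⟩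
  rw [ENNReal.rpow_one]
  exact hC m hm

end

end

theorem theorem1p15 (𝕜 : Type) [RCLike 𝕜] :
    ratioS (squeezeSymmetry.{u} 𝕜) (disjointSqueezeSymmetry.{u} 𝕜) = 1 ∧
    (ratioB (squeezeSymmetry.{u} 𝕜) (disjointSqueezeSymmetry.{u} 𝕜) = 2 ∧
      ratioM (squeezeSymmetry.{u} 𝕜) (disjointSqueezeSymmetry.{u} 𝕜) = 2) ∧
    (ratioB (democracy.{u} 𝕜) (disjointSqueezeSymmetry.{u} 𝕜) = 2 ∧
      ratioM (democracy.{u} 𝕜) (disjointSqueezeSymmetry.{u} 𝕜) = 2) ∧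
    (ratioB (superDemocracy.{u} 𝕜) (disjointSqueezeSymmetry.{u} 𝕜) = 2 ∧
      ratioM (superDemocracy.{u} 𝕜) (disjointSqueezeSymmetry.{u} 𝕜) = 2) ∧
    (ratioB (symmetryLargest.{u} 𝕜) (disjointSqueezeSymmetry.{u} 𝕜) = 2 ∧
      ratioM (symmetryLargest.{u} 𝕜) (disjointSqueezeSymmetry.{u} 𝕜) = 2) ∧
    (IsOptimalPower (squeezeSymmetry.{u} 𝕜) (disjointSqueezeSymmetry.{u} 𝕜) 2 ∧
      IsOptimalPower (democracy.{u} 𝕜) (disjointSqueezeSymmetry.{u} 𝕜) 2 ∧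
      IsOptimalPower (superDemocracy.{u} 𝕜) (disjointSqueezeSymmetry.{u} 𝕜) 2 ∧
      IsOptimalPower (symmetryLargest.{u} 𝕜) (disjointSqueezeSymmetry.{u} 𝕜) 2) := by
  have hlam : IsOptimalPower (squeezeSymmetry.{u} 𝕜) (disjointSqueezeSymmetry.{u} 𝕜) 2 :=
    isOptimalPower_two
      (fun X _ _ _ _ _ S m =>
        (S.democracy_le_superDemocracy m).trans (S.superDemocracy_le_squeezeSymmetry m))
      (fun X _ _ _ _ _ S => ⟨1, fun m _ => by simp⟩)
  have hmu : IsOptimalPower (democracy.{u} 𝕜) (disjointSqueezeSymmetry.{u} 𝕜) 2 :=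
    isOptimalPower_two (fun X _ _ _ _ _ S m => le_rfl)
      (fun X _ _ _ _ _ S => ⟨1, fun m _ => by
        simpa using
          (S.democracy_le_superDemocracy m).trans (S.superDemocracy_le_squeezeSymmetry m)⟩)
  have hmus : IsOptimalPower (superDemocracy.{u} 𝕜) (disjointSqueezeSymmetry.{u} 𝕜) 2 :=
    isOptimalPower_two (fun X _ _ _ _ _ S m => S.democracy_le_superDemocracy m)
      (fun X _ _ _ _ _ S => ⟨1, fun m _ => by
        simpa using S.superDemocracy_le_squeezeSymmetry m⟩)
  have hnu : IsOptimalPower (symmetryLargest.{u} 𝕜) (disjointSqueezeSymmetry.{u} 𝕜) 2 :=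
    isOptimalPower_two
      (fun X _ _ _ _ _ S m =>
        (S.democracy_le_superDemocracy m).trans (S.superDemocracy_le_symmetryLargest m))
      (fun X _ _ _ _ _ S => S.exists_symmetryLargest_le.imp fun _ h => h.2)
  exact ⟨sInf_image_coe_eq one_mem_exponentsS fun r hr => notMem_exponentsS_of_lt_one 𝕜 hr,
    ⟨hlam.ratioB_eq, hlam.ratioM_eq⟩, ⟨hmu.ratioB_eq, hmu.ratioM_eq⟩,
    ⟨hmus.ratioB_eq, hmus.ratioM_eq⟩, ⟨hnu.ratioB_eq, hnu.ratioM_eq⟩, hlam, hmu, hmus, hnu⟩
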